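/- Let $\mathbb K$ be a field of characteristic $0$. A DG-vector space is a $\mathbb Z$-graded cochain complex of $\mathbb K$-vector spaces (differential of degree $+1$); a DG-pair $(V,F)$ is a DG-vector space $V$ together with a DG-subspace $F\subseteq V$. Two DG-pairs are *homotopy equivalent* if their inclusions $F\hookrightarrow V$ and $\tilde F\hookrightarrow\tilde V$ are joined by a zigzag of weak equivalences in the category of morphisms of DG-vector spaces, a weak equivalence being a commutative square whose two components are quasi-isomorphisms. Two DG-Lie algebras are *homotopy equivalent* if they are joined by a zigzag of quasi-isomorphisms of DG-Lie algebras. Let $\operatorname{End}^*(V)=\operatorname{Hom}^*_{\mathbb K}(V,V)$ with the graded commutator, and let $\operatorname{End}^*(V;F)=\{\xi\in\operatorname{End}^*(V)\mid\xi(F)\subseteq F\}$. With $\mathbb K$ placed in degree $0$, let $$\operatorname{Aff}(V)=\{\xi\in\operatorname{End}^*(V\oplus\mathbb K)\mid\xi(V\oplus\mathbb K)\subseteq V\},\qquad \operatorname{Aff}(V;F)=\{\xi\in\operatorname{Aff}(V)\mid\xi(F\oplus\mathbb K)\subseteq F\}.$$ The *Jacobian square* of $(V,F)$ is the commutative square of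 DG-Lie algebras $$\begin{array}{ccc}\operatorname{End}^*(V;F)&\to&\operatorname{End}^*(V)\\ \downarrow&&\downarrow\\ \operatorname{Aff}(V;F)&\to&\operatorname{Aff}(V)\end{array}$$ whose horizontal maps are the inclusions and whose vertical maps are the extensions by zero $\xi\mapsto\xi\oplus 0$. A commutative square of DG-Lie algebras with top row $\mathfrak g_{00}\to\mathfrak g_{01}$ and bottom row $\mathfrak g_{10}\to\mathfrak g_{11}$ is *fibrant* if $\mathfrak g_{01}\to\mathfrak g_{11}$, $\mathfrak g_{10}\to\mathfrak g_{11}$ and $\mathfrak g_{00}\to\mathfrak g_{10}\times_{\mathfrak g_{11}}\mathfrak g_{01}$ are surjective; its *double fiber* is then $\ker(\mathfrak g_{00}\to\mathfrak g_{10}\times_{\mathfrak g_{11}}\mathfrak g_{01})$. A *double homotopy fiber* of a commutative square $\mathfrak g_{\bullet\bullet}$ is a DG-Lie algebra isomorphic to the double fiber of a fibrant square $\tilde{\mathfrak g}_{\bullet\bullet}$ for which there is a morphism of squares $\mathfrak g_{\bullet\bullet}\to\tilde{\mathfrak g}_{\bullet\bullet}$ with all four components quasi-isomorphisms. The *Jacobian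 DG-Lie algebra* $\mathfrak J(V,F)$ is the double homotopy fiber of the Jacobian square of $(V,F)$. **Corollary.** If $(V,F)$ and $(\tilde V,\tilde F)$ are homotopy equivalent DG-pairs, then $\mathfrak J(V,F)$ and $\mathfrak J(\tilde V,\tilde F)$ are homotopy equivalent DG-Lie algebras. That is, the Jacobian squares of $(V,F)$ and of $(\tilde V,\tilde F)$ have double homotopy fibers, and every double homotopy fiber of the one is homotopy equivalent to every double homotopy fiber of the other. -/

import Mathlib

open CategoryTheory CochainComplex CochainComplex.HomComplex

universe u w

noncomputable section

/-- Differential graded (DG) vector spaces over `K`, with differential of degree `+1`. -/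
abbrev DGVect (K : Type u) [Field K] := CochainComplex (ModuleCat.{w} K) ℤ

/-- The DG-subspace of a DG-vector space cut out by a `d`-stable family of subspaces. -/
@[simps]
def DGVect.sub {K : Type u} [Field K] (V : DGVect.{u, w} K) (F : ∀ n, Submodule K (V.X n))
    (hF : ∀ i j, ∀ x ∈ F i, (V.d i j).hom x ∈ F j) : DGVect.{u, w} K where
  X n := ModuleCat.of K (F n)
  d i j := ModuleCat.ofHom ((V.d i j).hom.restrict (hF i j))
  shape i j hij := by
    ext x
    change (V.d i j).hom x.1 = 0
    rw [V.shape i j hij]; rfl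
  d_comp_d' i j k _ _ := by
    ext x
    change (V.d i j ≫ V.d j k).hom x.1 = 0
    rw [V.d_comp_d]; rfl

/-- The inclusion of a DG-subspace. -/
@[simps]
def DGVect.subι {K : Type u} [Field K] (V : DGVect.{u, w} K) (F : ∀ n, Submodule K (V.X n))
    (hF : ∀ i j, ∀ x ∈ F i, (V.d i j).hom x ∈ F j) : V.sub F hF ⟶ V where
  f n := ModuleCat.ofHom (F n).subtype
  comm' _ _ _ := rfl

/-! ### Differential graded Lie algebras -/

/-- A differential graded Lie algebra over `K` (over a field of characteristic `0`, graded
skew-symmetry, the graded Jacobi identity and the graded Leibniz rule are the usual axioms). -/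
structure DGLA (K : Type u) [Field K] where
  /-- the underlying DG-vector space -/
  cx : DGVect.{u, w} K
  /-- the bracket, homogeneous of degree `0` -/
  bracket : ∀ {p q r : ℤ}, p + q = r → (cx.X p →ₗ[K] cx.X q →ₗ[K] cx.X r)
  /-- `[x, y] = -(-1)^{|x||y|} [y, x]` -/
  skew : ∀ {p q r : ℤ} (h : p + q = r) (h' : q + p = r) (x : cx.X p) (y : cx.X q),
    bracket h x y = -((p * q).negOnePow • bracket h' y x)
  /-- `[x, [y, z]] = [[x, y], z] + (-1)^{|x||y|} [y, [x, z]]` -/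
  jacobi : ∀ {p q r pq qr pr s : ℤ} (hpq : p + q = pq) (hqr : q + r = qr) (hpr : p + r = pr)
    (h₁ : p + qr = s) (h₂ : pq + r = s) (h₃ : q + pr = s)
    (x : cx.X p) (y : cx.X q) (z : cx.X r),
    bracket h₁ x (bracket hqr y z) =
      bracket h₂ (bracket hpq x y) z + (p * q).negOnePow • bracket h₃ y (bracket hpr x z)
  /-- `d[x, y] = [dx, y] + (-1)^{|x|} [x, dy]` -/
  leibniz : ∀ {p q r p' q' r' : ℤ} (h : p + q = r) (_ : r + 1 = r') (h₁ : p' + q = r') (h₂ : p + q' = r') (x : cx.X p) (y : cx.X q),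
    (cx.d r r').hom (bracket h x y) =
      bracket h₁ ((cx.d p p').hom x) y + p.negOnePow • bracket h₂ x ((cx.d q q').hom y)

namespace DGLA

variable {K : Type u} [Field K]

/-- Morphisms of DG-Lie algebras: morphisms of DG-vector spaces preserving the bracket. -/
@[ext]
structure Hom (L M : DGLA.{u, w} K) where
  /-- the underlying morphism of DG-vector spaces -/
  hom : L.cx ⟶ M.cx
  map_bracket : ∀ {p q r : ℤ} (h : p + q = r) (x : L.cx.X p) (y : L.cx.X q),
    (hom.f r).hom (L.bracket h x y) = M.bracket h ((hom.f p).hom x) ((hom.f q).hom y)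

instance : Category (DGLA.{u, w} K) where
  Hom L M := Hom L M
  id L := ⟨𝟙 L.cx, fun _ _ _ => rfl⟩
  comp f g := ⟨f.hom ≫ g.hom, fun h x y => by
    change (g.hom.f _).hom ((f.hom.f _).hom _) = _
    rw [f.map_bracket, g.map_bracket]; rfl⟩

/-- A morphism of DG-Lie algebras is a weak equivalence if it is a quasi-isomorphism. -/
def IsWeakEquiv {L M : DGLA.{u, w} K} (f : L ⟶ M) : Prop :=
  QuasiIso (Hom.hom f)

/-- Two DG-Lie algebras are homotopy equivalent if they are joined by a zigzag of
quasi-isomorphisms of DG-Lie algebras. -/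
def HomotopyEquivalent (L M : DGLA.{u, w} K) : Prop :=
  Relation.EqvGen (fun A B : DGLA.{u, w} K => ∃ f : A ⟶ B, IsWeakEquiv f) L M

/-- The DG-Lie subalgebra given by a family of subspaces stable under differential and bracket. -/
def sub (L : DGLA.{u, w} K) (S : ∀ n, Submodule K (L.cx.X n))
    (hd : ∀ i j, ∀ x ∈ S i, (L.cx.d i j).hom x ∈ S j)
    (hb : ∀ {p q r : ℤ} (h : p + q = r), ∀ x ∈ S p, ∀ y ∈ S q, L.bracket h x y ∈ S r) :
    DGLA.{u, w} K where
  cx := L.cx.sub S hd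
  bracket {p q r} h := LinearMap.mk₂ K
    (fun (x : S p) (y : S q) => (⟨L.bracket h x.1 y.1, hb h _ x.2 _ y.2⟩ : S r))
    (fun _ _ _ => Subtype.ext (LinearMap.map_add₂ _ _ _ _))
    (fun _ _ _ => Subtype.ext (LinearMap.map_smul₂ _ _ _ _))
    (fun _ _ _ => Subtype.ext (map_add _ _ _)) (fun _ _ _ => Subtype.ext (map_smul _ _ _))
  skew h h' x y := Subtype.ext (L.skew h h' x.1 y.1)
  jacobi a b c d e f x y z := Subtype.ext (L.jacobi a b c d e f x.1 y.1 z.1)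
  leibniz a b c d x y := Subtype.ext (L.leibniz a b c d x.1 y.1)

/-- The inclusion of a DG-Lie subalgebra. -/
def subι (L : DGLA.{u, w} K) (S : ∀ n, Submodule K (L.cx.X n))
    (hd : ∀ i j, ∀ x ∈ S i, (L.cx.d i j).hom x ∈ S j)
    (hb : ∀ {p q r : ℤ} (h : p + q = r), ∀ x ∈ S p, ∀ y ∈ S q, L.bracket h x y ∈ S r) :
    L.sub S hd hb ⟶ L :=
  Hom.mk (L.cx.subι S hd) (fun _ _ _ => rfl)

/-- A morphism of DG-Lie algebras with values in a DG-Lie subalgebra. -/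
def subLift {L M : DGLA.{u, w} K} (f : M ⟶ L) (S : ∀ n, Submodule K (L.cx.X n))
    (hd : ∀ i j, ∀ x ∈ S i, (L.cx.d i j).hom x ∈ S j)
    (hb : ∀ {p q r : ℤ} (h : p + q = r), ∀ x ∈ S p, ∀ y ∈ S q, L.bracket h x y ∈ S r)
    (hf : ∀ n (x : M.cx.X n), ((Hom.hom f).f n).hom x ∈ S n) :
    M ⟶ L.sub S hd hb :=
  Hom.mk
    { f := fun n => ModuleCat.ofHom (((Hom.hom f).f n).hom.codRestrict (S n) (hf n))
      comm' := fun i j _ => by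
        ext x
        apply Subtype.ext
        exact LinearMap.congr_fun (congrArg ModuleCat.Hom.hom ((Hom.hom f).comm i j)) x }
    (fun h x y => Subtype.ext (Hom.map_bracket f h x y))

end DGLA

/-! ### Double homotopy fibers of commutative squares of DG-Lie algebras

A commutative square `𝔤` has corners `X₁ = 𝔤₀₀`, `X₂ = 𝔤₀₁`, `X₃ = 𝔤₁₀`, `X₄ = 𝔤₁₁`. -/

namespace DGLA

variable {K : Type u} [Field K]

/-- Weak equivalences of squares are objectwise. -/
def IsSquareWeakEquiv {S T : Square (DGLA.{u, w} K)} (φ : S ⟶ T) : Prop :=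
  IsWeakEquiv φ.τ₁ ∧ IsWeakEquiv φ.τ₂ ∧ IsWeakEquiv φ.τ₃ ∧ IsWeakEquiv φ.τ₄

/-- Fibrant squares in the inverse Reedy model structure: `𝔤₀₁ → 𝔤₁₁`, `𝔤₁₀ → 𝔤₁₁` and
`𝔤₀₀ → 𝔤₀₁ ×_{𝔤₁₁} 𝔤₁₀` are surjective. -/
def IsFibrantSquare (T : Square (DGLA.{u, w} K)) : Prop :=
  (∀ n, Function.Surjective ((Hom.hom T.f₂₄).f n).hom) ∧
  (∀ n, Function.Surjective ((Hom.hom T.f₃₄).f n).hom) ∧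
  ∀ n (x : T.X₂.cx.X n) (y : T.X₃.cx.X n),
    ((Hom.hom T.f₂₄).f n).hom x = ((Hom.hom T.f₃₄).f n).hom y →
    ∃ z : T.X₁.cx.X n,
      ((Hom.hom T.f₁₂).f n).hom z = x ∧ ((Hom.hom T.f₁₃).f n).hom z = y

/-- The double fiber `ker (𝔤₀₀ → 𝔤₁₀ ×_{𝔤₁₁} 𝔤₀₁)`, as a DG-Lie subalgebra of `𝔤₀₀`. -/
def doubleFiber (T : Square (DGLA.{u, w} K)) : DGLA.{u, w} K :=
  T.X₁.sub
    (fun n => LinearMap.ker ((Hom.hom T.f₁₂).f n).hom ⊓ LinearMap.ker ((Hom.hom T.f₁₃).f n).hom)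
    (by
      rintro i j x ⟨h₁, h₂⟩
      have key : ∀ {M : DGLA.{u, w} K} (f : T.X₁ ⟶ M), ((Hom.hom f).f i).hom x = 0 →
          ((Hom.hom f).f j).hom ((T.X₁.cx.d i j).hom x) = 0 := by
        intro M f hx
        have := LinearMap.congr_fun (congrArg ModuleCat.Hom.hom ((Hom.hom f).comm i j)) x
        change (M.cx.d i j).hom (((Hom.hom f).f i).hom x) = _ at this
        rw [hx, map_zero] at this
        exact this.symm
      exact ⟨key _ h₁, key _ h₂⟩)
    (by
      rintro p q r h x ⟨h₁, h₂⟩ y -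
      have key : ∀ {M : DGLA.{u, w} K} (f : T.X₁ ⟶ M), ((Hom.hom f).f p).hom x = 0 →
          ((Hom.hom f).f r).hom (T.X₁.bracket h x y) = 0 := by
        intro M f hx
        rw [Hom.map_bracket f, hx]
        simp
      exact ⟨key _ h₁, key _ h₂⟩)

/-- `L` is a double homotopy fiber of the square `S`: it is (isomorphic to) the double fiber of
some fibrant resolution `S ⟶ T`. -/
def IsDoubleHomotopyFiber (S : Square (DGLA.{u, w} K)) (L : DGLA.{u, w} K) : Prop :=
  ∃ (T : Square (DGLA.{u, w} K)) (φ : S ⟶ T),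
    IsSquareWeakEquiv φ ∧ IsFibrantSquare T ∧ Nonempty (L ≅ doubleFiber T)

end DGLA

/-! ### Endomorphisms -/

namespace DGVect

variable {K : Type u} [Field K]

/-- The DG-vector space `Hom^*(V, V)`, with differential `ξ ↦ d ∘ ξ - (-1)^{|ξ|} ξ ∘ d`. -/
@[simps]
def endCx (V : DGVect.{u, w} K) : DGVect.{u, w} K where
  X n := ModuleCat.of K (Cochain V V n)
  d i j := ModuleCat.ofHom (δ_hom K V V i j)
  shape i j hij := by
    ext x : 2
    exact δ_shape _ _ hij x
  d_comp_d' i j k _ _ := by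
    ext x : 2
    exact δ_δ i j k x

/-- The commutator `[ξ, η] = ξ ∘ η - (-1)^{|ξ||η|} η ∘ ξ`
(in `Cochain.comp` the first argument is applied first). -/
def commutator (V : DGVect.{u, w} K) {p q r : ℤ} (h : p + q = r)
    (ξ : Cochain V V p) (η : Cochain V V q) : Cochain V V r :=
  η.comp ξ (by lia) - (p * q).negOnePow • ξ.comp η h

lemma commutator_skew (V : DGVect.{u, w} K) {p q r : ℤ} (h : p + q = r) (h' : q + p = r)
    (x : Cochain V V p) (y : Cochain V V q) :
    V.commutator h x y = -((p * q).negOnePow • V.commutator h' y x) := by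
  simp only [commutator, mul_comm q p]
  obtain e | e := Int.units_eq_one_or (p * q).negOnePow <;> simp [e]

lemma commutator_jacobi (V : DGVect.{u, w} K) {p q r pq qr pr s : ℤ}
    (hpq : p + q = pq) (hqr : q + r = qr) (hpr : p + r = pr)
    (h₁ : p + qr = s) (h₂ : pq + r = s) (h₃ : q + pr = s)
    (x : Cochain V V p) (y : Cochain V V q) (z : Cochain V V r) :
    V.commutator h₁ x (V.commutator hqr y z) = V.commutator h₂ (V.commutator hpq x y) z +
      (p * q).negOnePow • V.commutator h₃ y (V.commutator hpr x z) := by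
  have a₁ : (p * qr).negOnePow = (p * q).negOnePow * (p * r).negOnePow := by
    rw [← hqr, mul_add, Int.negOnePow_add]
  have a₂ : (pq * r).negOnePow = (p * r).negOnePow * (q * r).negOnePow := by
    rw [← hpq, add_mul, Int.negOnePow_add]
  have a₃ : (q * pr).negOnePow = (p * q).negOnePow * (q * r).negOnePow := by
    rw [← hpr, mul_add, Int.negOnePow_add, mul_comm q p]
  have assoc : ∀ {a b c ab bc : ℤ} (hab : a + b = ab) (hbc : b + c = bc) (e₁ : ab + c = s)
      (e₂ : a + bc = s) (f : Cochain V V a) (g : Cochain V V b) (k : Cochain V V c),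
      (f.comp g hab).comp k e₁ = f.comp (g.comp k hbc) e₂ := by
    intro a b c ab bc hab hbc e₁ e₂ f g k
    exact Cochain.comp_assoc f g k hab hbc (by lia)
  simp only [commutator, a₁, a₂, a₃, Cochain.comp_sub, Cochain.sub_comp, Cochain.comp_units_smul,
    Cochain.units_smul_comp, smul_sub, smul_smul]
  rw [assoc (a := r) (b := q) (c := p) (bc := pq) (by lia) (by lia) (by lia) (by lia),
    assoc (a := q) (b := r) (c := p) (bc := pr) (by lia) (by lia) (by lia) (by lia),
    assoc (a := p) (b := r) (c := q) (bc := qr) (by lia) (by lia) (by lia) (by lia),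
    assoc (a := r) (b := p) (c := q) (bc := pq) (by lia) (by lia) (by lia) (by lia),
    assoc (a := q) (b := p) (c := r) (bc := pr) (by lia) (by lia) (by lia) (by lia),
    assoc (a := p) (b := q) (c := r) (bc := qr) (by lia) (by lia) (by lia) (by lia)]
  obtain e₁ | e₁ := Int.units_eq_one_or (p * q).negOnePow <;>
  obtain e₂ | e₂ := Int.units_eq_one_or (p * r).negOnePow <;>
  obtain e₃ | e₃ := Int.units_eq_one_or (q * r).negOnePow <;>
  simp [e₁, e₂, e₃] <;> abel

lemma commutator_leibniz (V : DGVect.{u, w} K) {p q r p' q' r' : ℤ} (h : p + q = r)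
    (hr : r + 1 = r') (h₁ : p' + q = r') (h₂ : p + q' = r')
    (x : Cochain V V p) (y : Cochain V V q) :
    δ r r' (V.commutator h x y) = V.commutator h₁ (δ p p' x) y +
      p.negOnePow • V.commutator h₂ x (δ q q' y) := by
  obtain rfl : p' = p + 1 := by lia
  obtain rfl : q' = q + 1 := by lia
  simp only [commutator, δ_sub, δ_units_smul, smul_sub, smul_smul]
  rw [δ_comp y x (by lia) (q + 1) (p + 1) r' hr rfl rfl,
    δ_comp x y h (p + 1) (q + 1) r' hr rfl rfl]
  have a₁ : ((p + 1) * q).negOnePow = (p * q).negOnePow * q.negOnePow := by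
    rw [add_mul, Int.negOnePow_add, one_mul]
  have a₂ : (p * (q + 1)).negOnePow = (p * q).negOnePow * p.negOnePow := by
    rw [mul_add, Int.negOnePow_add, mul_one]
  rw [a₁, a₂, smul_add, smul_smul]
  obtain e₁ | e₁ := Int.units_eq_one_or (p * q).negOnePow <;>
  obtain e₂ | e₂ := Int.units_eq_one_or p.negOnePow <;>
  obtain e₃ | e₃ := Int.units_eq_one_or q.negOnePow <;>
  simp [e₁, e₂, e₃] <;> abel

/-- The commutator as a bilinear map. -/
def commutatorHom (V : DGVect.{u, w} K) {p q r : ℤ} (h : p + q = r) :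
    Cochain V V p →ₗ[K] Cochain V V q →ₗ[K] Cochain V V r :=
  LinearMap.mk₂ K (fun ξ η => V.commutator h ξ η)
    (fun x x' y => by simp only [commutator, Cochain.add_comp, Cochain.comp_add, smul_add]; abel)
    (fun c x y => by
      simp only [commutator, Cochain.smul_comp, Cochain.comp_smul, smul_sub]
      rw [smul_comm])
    (fun x y y' => by simp only [commutator, Cochain.add_comp, Cochain.comp_add, smul_add]; abel)
    (fun c x y => by
      simp only [commutator, Cochain.smul_comp, Cochain.comp_smul, smul_sub]
      rw [smul_comm])

/-- The DG-Lie algebra `End^*(V)`. -/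
def End (V : DGVect.{u, w} K) : DGLA.{u, w} K where
  cx := V.endCx
  bracket h := V.commutatorHom h
  skew h h' x y := V.commutator_skew h h' x y
  jacobi hpq hqr hpr h₁ h₂ h₃ x y z := V.commutator_jacobi hpq hqr hpr h₁ h₂ h₃ x y z
  leibniz h hr h₁ h₂ x y := V.commutator_leibniz h hr h₁ h₂ x y

end DGVect

/-! ### Affine endomorphisms -/

namespace DGVect

variable {K : Type u} [Field K]

/-- The degree `n` part of the DG-vector space `K` concentrated in degree `0`. -/
def unitPart (K : Type u) [Field K] (n : ℤ) : Submodule K K := if n = 0 then ⊤ else ⊥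

/-- The DG-vector space `V ⊕ K`, with `K` in degree `0`. -/
@[simps]
def addUnit (V : DGVect.{u, max w u} K) : DGVect.{u, max w u} K where
  X n := ModuleCat.of K (V.X n × unitPart K n)
  d i j := ModuleCat.ofHom
    (LinearMap.inl K (V.X j) (unitPart K j) ∘ₗ (V.d i j).hom ∘ₗ LinearMap.fst K _ _)
  shape i j hij := by
    rw [V.shape i j hij]; ext : 2 <;> rfl
  d_comp_d' i j k _ _ := by
    have h : ∀ x, (V.d j k).hom ((V.d i j).hom x) = 0 := fun x => by
      change (V.d i j ≫ V.d j k).hom x = 0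
      rw [V.d_comp_d]; rfl
    apply ModuleCat.hom_ext
    exact LinearMap.ext fun x => Prod.ext (h x.1) rfl

/-- The inclusion `V ⟶ V ⊕ K`. -/
@[simps]
def addUnitInl (V : DGVect.{u, max w u} K) : V ⟶ addUnit.{u, w} V where
  f n := ModuleCat.ofHom (LinearMap.inl K (V.X n) (unitPart K n))
  comm' _ _ _ := rfl

/-- The projection `V ⊕ K ⟶ V`. -/
@[simps]
def addUnitFst (V : DGVect.{u, max w u} K) : addUnit.{u, w} V ⟶ V where
  f n := ModuleCat.ofHom (LinearMap.fst K (V.X n) (unitPart K n))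
  comm' _ _ _ := rfl

lemma inl_fst (V : DGVect.{u, max w u} K) :
    addUnitInl.{u, w} V ≫ addUnitFst.{u, w} V = 𝟙 V := rfl

/-- The extension by zero `ξ ↦ ξ ⊕ 0` of an endomorphism of `V` to `V ⊕ K`. -/
def extend (V : DGVect.{u, max w u} K) {n : ℤ} (ξ : Cochain V V n) :
    Cochain (addUnit.{u, w} V) (addUnit.{u, w} V) n :=
  (Cochain.ofHom (addUnitFst.{u, w} V)).comp
    (ξ.comp (Cochain.ofHom (addUnitInl.{u, w} V)) (add_zero n)) (zero_add n)

lemma extend_v (V : DGVect.{u, max w u} K) {n : ℤ} (ξ : Cochain V V n) (p q : ℤ)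
    (h : p + n = q) :
    (extend.{u, w} V ξ).v p q h =
      (addUnitFst.{u, w} V).f p ≫ ξ.v p q h ≫ (addUnitInl.{u, w} V).f q := by
  simp [extend]

lemma extend_comp (V : DGVect.{u, max w u} K) {p q r : ℤ} (h : p + q = r)
    (ξ : Cochain V V p) (η : Cochain V V q) :
    extend.{u, w} V (ξ.comp η h) = (extend.{u, w} V ξ).comp (extend.{u, w} V η) h := by
  ext a b hab : 1
  have : ∀ n, (addUnitInl.{u, w} V).f n ≫ (addUnitFst.{u, w} V).f n = 𝟙 _ := fun _ => rfl
  rw [Cochain.comp_v _ _ h a (a + p) b rfl (by lia), extend_v, extend_v, extend_v,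
    Cochain.comp_v _ _ h a (a + p) b rfl (by lia)]
  simp only [Category.assoc]
  rw [reassoc_of% this]

lemma extend_commutator (V : DGVect.{u, max w u} K) {p q r : ℤ} (h : p + q = r)
    (ξ : Cochain V V p) (η : Cochain V V q) :
    extend.{u, w} V (V.commutator h ξ η) =
      (addUnit.{u, w} V).commutator h (extend.{u, w} V ξ) (extend.{u, w} V η) := by
  simp only [commutator, ← extend_comp]
  simp only [extend, Cochain.sub_comp, Cochain.comp_sub, Cochain.units_smul_comp,
    Cochain.comp_units_smul]

/-- The DG-Lie algebra morphism `End^*(V) ⟶ End^*(V ⊕ K)`, `ξ ↦ ξ ⊕ 0`. -/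
def extendEnd (V : DGVect.{u, max w u} K) : V.End ⟶ (addUnit.{u, w} V).End :=
  DGLA.Hom.mk (L := V.End) (M := (addUnit.{u, w} V).End)
    { f := fun n => ModuleCat.ofHom
        (X := Cochain V V n) (Y := Cochain (addUnit.{u, w} V) (addUnit.{u, w} V) n)
        { toFun := fun ξ => extend.{u, w} V ξ
          map_add' := fun x y => by simp only [extend, Cochain.add_comp, Cochain.comp_add]
          map_smul' := fun c x => by
            simp only [extend, Cochain.smul_comp, Cochain.comp_smul, RingHom.id_apply] }
      comm' := fun i j _ => by
        apply ModuleCat.hom_ext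
        refine LinearMap.ext fun x : Cochain V V i => ?_
        change δ i j (extend.{u, w} V x) = extend.{u, w} V (δ i j x)
        simp only [extend, δ_ofHom_comp, δ_comp_ofHom] }
    (fun h x y => extend_commutator.{u, w} V h x y)

end DGVect

/-- A pair `(V, F)` of DG-vector spaces: a DG-vector space `V` and a DG-subspace `F ⊆ V`. -/
structure DGPair (K : Type u) [Field K] where
  /-- the ambient DG-vector space -/
  V : DGVect.{u, w} K
  /-- the homogeneous components of the DG-subspace -/
  F : ∀ n, Submodule K (V.X n)
  d_mem : ∀ i j, ∀ x ∈ F i, (V.d i j).hom x ∈ F j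

namespace DGPair

variable {K : Type u} [Field K]

/-- The inclusion `F ↪ V`, as an object of `Fun(Δ¹, DG)`. -/
def arrow (P : DGPair.{u, w} K) : Arrow (DGVect.{u, w} K) :=
  Arrow.mk (P.V.subι P.F P.d_mem)

/-- Two DG-pairs are homotopy equivalent if they are joined by a zigzag of weak equivalences in
`Fun(Δ¹, DG)`, i.e. of morphisms of arrows with both components quasi-isomorphisms. -/
def HomotopyEquivalent (P Q : DGPair.{u, w} K) : Prop :=
  Relation.EqvGen (fun A B : Arrow (DGVect.{u, w} K) =>
    ∃ f : A ⟶ B, QuasiIso f.left ∧ QuasiIso f.right) P.arrow Q.arrow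

end DGPair

/-! ### Endomorphisms and affine endomorphisms of a pair -/

namespace DGVect

variable {K : Type u} [Field K]

/-- The endomorphisms `ξ` of degree `n` with `ξ(A) ⊆ B`. -/
def mapsInto (W : DGVect.{u, w} K) (A B : ∀ n, Submodule K (W.X n)) (n : ℤ) :
    Submodule K (Cochain W W n) where
  carrier := {ξ | ∀ (p q : ℤ) (h : p + n = q), ∀ x ∈ A p, (ξ.v p q h).hom x ∈ B q}
  add_mem' hξ hη p q h x hx := (B q).add_mem (hξ p q h x hx) (hη p q h x hx)
  zero_mem' _ q _ _ _ := (B q).zero_mem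
  smul_mem' c _ hξ p q h x hx := (B q).smul_mem c (hξ p q h x hx)

lemma comp_mem_mapsInto (W : DGVect.{u, w} K) {A B C : ∀ n, Submodule K (W.X n)} {p q r : ℤ}
    (h : q + p = r) {ξ : Cochain W W p} {η : Cochain W W q}
    (hξ : ξ ∈ W.mapsInto B C p) (hη : η ∈ W.mapsInto A B q) :
    η.comp ξ h ∈ W.mapsInto A C r := by
  intro a b hab x hx
  rw [Cochain.comp_v _ _ h a (a + q) b rfl (by lia)]
  exact hξ _ _ _ _ (hη _ _ _ _ hx)

lemma δ_mem_mapsInto (W : DGVect.{u, w} K) {A B : ∀ n, Submodule K (W.X n)}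
    (hA : ∀ i j, ∀ x ∈ A i, (W.d i j).hom x ∈ A j) (hB : ∀ i j, ∀ x ∈ B i, (W.d i j).hom x ∈ B j)
    (i j : ℤ) {ξ : Cochain W W i} (hξ : ξ ∈ W.mapsInto A B i) : δ i j ξ ∈ W.mapsInto A B j := by
  by_cases hij : i + 1 = j
  · intro a b hab x hx
    rw [δ_v i j hij ξ a b hab (b - 1) (a + 1) rfl rfl]
    have h₁ := hB (b - 1) b _ (hξ a (b - 1) (by lia) x hx)
    have h₂ := hξ (a + 1) b (by lia) _ (hA a (a + 1) x hx)
    refine (B b).add_mem h₁ ?_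
    obtain e | e := Int.units_eq_one_or j.negOnePow
    · rw [e, one_smul]; exact h₂
    · rw [e, Units.neg_smul, one_smul]; exact (B b).neg_mem h₂
  · rw [δ_shape _ _ hij]; exact zero_mem _

lemma commutator_mem_mapsInto (W : DGVect.{u, w} K) {A B : ∀ n, Submodule K (W.X n)}
    (hBA : ∀ n, B n ≤ A n) {p q r : ℤ} (h : p + q = r) {ξ : Cochain W W p} {η : Cochain W W q}
    (hξ : ξ ∈ W.mapsInto A B p) (hη : η ∈ W.mapsInto A B q) :
    W.commutator h ξ η ∈ W.mapsInto A B r := by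
  have mono : ∀ {n : ℤ} {ζ : Cochain W W n}, ζ ∈ W.mapsInto A B n → ζ ∈ W.mapsInto B B n :=
    fun hζ a b hab x hx => hζ a b hab x (hBA _ hx)
  have h₁ := W.comp_mem_mapsInto (by lia : q + p = r) (mono hξ) hη
  have h₂ := W.comp_mem_mapsInto h (mono hη) hξ
  refine sub_mem h₁ ?_
  obtain e | e := Int.units_eq_one_or (p * q).negOnePow
  · rw [e, one_smul]; exact h₂
  · rw [e, Units.neg_smul, one_smul]; exact neg_mem h₂

/-- The subspace `G ⊕ K` of `V ⊕ K`, for `G ⊆ V`. -/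
def withUnit (V : DGVect.{u, max w u} K) (G : ∀ n, Submodule K (V.X n)) (n : ℤ) :
    Submodule K ((addUnit.{u, w} V).X n) :=
  (G n).prod (⊤ : Submodule K (unitPart K n))

/-- The subspace `G = G ⊕ 0` of `V ⊕ K`, for `G ⊆ V`. -/
def withoutUnit (V : DGVect.{u, max w u} K) (G : ∀ n, Submodule K (V.X n)) (n : ℤ) :
    Submodule K ((addUnit.{u, w} V).X n) :=
  (G n).prod (⊥ : Submodule K (unitPart K n))

lemma d_mem_withUnit (V : DGVect.{u, max w u} K) {G : ∀ n, Submodule K (V.X n)}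
    (hG : ∀ i j, ∀ x ∈ G i, (V.d i j).hom x ∈ G j) (i j : ℤ) :
    ∀ x ∈ withUnit.{u, w} V G i, ((addUnit.{u, w} V).d i j).hom x ∈ withUnit.{u, w} V G j :=
  fun _ hx => ⟨hG i j _ hx.1, trivial⟩

lemma d_mem_withoutUnit (V : DGVect.{u, max w u} K) {G : ∀ n, Submodule K (V.X n)}
    (hG : ∀ i j, ∀ x ∈ G i, (V.d i j).hom x ∈ G j) (i j : ℤ) :
    ∀ x ∈ withoutUnit.{u, w} V G i,
      ((addUnit.{u, w} V).d i j).hom x ∈ withoutUnit.{u, w} V G j :=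
  fun _ hx => ⟨hG i j _ hx.1, rfl⟩

/-- `{ξ ∈ End^n(V ⊕ K) ∣ ξ(V ⊕ K) ⊆ V}`, the degree `n` part of `Aff(V)`. -/
def affPart (V : DGVect.{u, max w u} K) (n : ℤ) :
    Submodule K (Cochain (addUnit.{u, w} V) (addUnit.{u, w} V) n) :=
  (addUnit.{u, w} V).mapsInto (withUnit.{u, w} V fun _ => ⊤) (withoutUnit.{u, w} V fun _ => ⊤) n

lemma δ_mem_affine (V : DGVect.{u, max w u} K) {G : ∀ n, Submodule K (V.X n)}
    (hG : ∀ i j, ∀ x ∈ G i, (V.d i j).hom x ∈ G j) (i j : ℤ)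
    {ξ : Cochain (addUnit.{u, w} V) (addUnit.{u, w} V) i}
    (hξ : ξ ∈ (addUnit.{u, w} V).mapsInto (withUnit.{u, w} V G) (withoutUnit.{u, w} V G) i) :
    δ i j ξ ∈ (addUnit.{u, w} V).mapsInto (withUnit.{u, w} V G) (withoutUnit.{u, w} V G) j :=
  δ_mem_mapsInto _ (d_mem_withUnit.{u, w} V hG) (d_mem_withoutUnit.{u, w} V hG) i j hξ

lemma commutator_mem_affine (V : DGVect.{u, max w u} K) {G : ∀ n, Submodule K (V.X n)}
    {p q r : ℤ} (h : p + q = r)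
    {ξ : Cochain (addUnit.{u, w} V) (addUnit.{u, w} V) p}
    {η : Cochain (addUnit.{u, w} V) (addUnit.{u, w} V) q}
    (hξ : ξ ∈ (addUnit.{u, w} V).mapsInto (withUnit.{u, w} V G) (withoutUnit.{u, w} V G) p)
    (hη : η ∈ (addUnit.{u, w} V).mapsInto (withUnit.{u, w} V G) (withoutUnit.{u, w} V G) q) :
    (addUnit.{u, w} V).commutator h ξ η ∈
      (addUnit.{u, w} V).mapsInto (withUnit.{u, w} V G) (withoutUnit.{u, w} V G) r :=
  commutator_mem_mapsInto _ (fun _ => Submodule.prod_mono le_rfl bot_le) h hξ hη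

lemma δ_mem_affPart (V : DGVect.{u, max w u} K) (i j : ℤ) :
    ∀ x ∈ affPart.{u, w} V i, δ i j x ∈ affPart.{u, w} V j :=
  fun _ hx => δ_mem_affine.{u, w} V (G := fun _ => ⊤) (fun _ _ _ _ => trivial) i j hx

lemma commutator_mem_affPart (V : DGVect.{u, max w u} K) {p q r : ℤ} (h : p + q = r) :
    ∀ x ∈ affPart.{u, w} V p, ∀ y ∈ affPart.{u, w} V q,
      (addUnit.{u, w} V).commutator h x y ∈ affPart.{u, w} V r :=
  fun _ hx _ hy => commutator_mem_affine.{u, w} V h hx hy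

/-- The DG-Lie algebra `Aff(V)` of affine endomorphisms of `V`. -/
def Aff (V : DGVect.{u, max w u} K) : DGLA.{u, max w u} K :=
  (addUnit.{u, w} V).End.sub (affPart.{u, w} V) (δ_mem_affPart.{u, w} V)
    (commutator_mem_affPart.{u, w} V)

lemma extend_mem (V : DGVect.{u, max w u} K) {G : ∀ n, Submodule K (V.X n)} {n : ℤ}
    {ξ : Cochain V V n} (hξ : ξ ∈ V.mapsInto G G n) :
    extend.{u, w} V ξ ∈
      (addUnit.{u, w} V).mapsInto (withUnit.{u, w} V G) (withoutUnit.{u, w} V G) n := by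
  intro p q h x hx
  rw [extend_v]
  exact ⟨hξ p q h _ hx.1, rfl⟩

/-- The canonical embedding `σ₀ : End^*(V) ⟶ Aff(V)`. -/
def sigma (V : DGVect.{u, max w u} K) : V.End ⟶ Aff.{u, w} V :=
  DGLA.subLift (extendEnd.{u, w} V) (affPart.{u, w} V) (δ_mem_affPart.{u, w} V)
    (commutator_mem_affPart.{u, w} V)
    (fun n (x : Cochain V V n) =>
      extend_mem.{u, w} V (G := fun _ => ⊤) (ξ := x) fun _ _ _ _ _ => trivial)

end DGVect

namespace DGPair

variable {K : Type u} [Field K]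

/-- `{ξ ∈ End^n(V) ∣ ξ(F) ⊆ F}`, the degree `n` part of `End^*(V; F)`. -/
def endPart (P : DGPair.{u, w} K) (n : ℤ) : Submodule K (Cochain P.V P.V n) :=
  P.V.mapsInto P.F P.F n

lemma δ_mem_endPart (P : DGPair.{u, w} K) (i j : ℤ) :
    ∀ x ∈ P.endPart i, δ i j x ∈ P.endPart j :=
  fun _ hx => DGVect.δ_mem_mapsInto _ P.d_mem P.d_mem i j hx

lemma commutator_mem_endPart (P : DGPair.{u, w} K) {p q r : ℤ} (h : p + q = r) :
    ∀ x ∈ P.endPart p, ∀ y ∈ P.endPart q, P.V.commutator h x y ∈ P.endPart r :=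
  fun _ hx _ hy => P.V.commutator_mem_mapsInto (fun _ => le_rfl) h hx hy

/-- The DG-Lie algebra `End^*(V; F)`. -/
def End (P : DGPair.{u, w} K) : DGLA.{u, w} K :=
  P.V.End.sub P.endPart P.δ_mem_endPart P.commutator_mem_endPart

/-- The inclusion `End^*(V; F) ⟶ End^*(V)`. -/
def endι (P : DGPair.{u, w} K) : P.End ⟶ P.V.End :=
  DGLA.subι P.V.End P.endPart P.δ_mem_endPart P.commutator_mem_endPart

/-- `{ξ ∈ End^n(V ⊕ K) ∣ ξ(V ⊕ K) ⊆ V, ξ(F ⊕ K) ⊆ F}`, the degree `n` part of `Aff(V; F)`. -/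
def affPart (P : DGPair.{u, max w u} K) (n : ℤ) :
    Submodule K (Cochain (DGVect.addUnit.{u, w} P.V) (DGVect.addUnit.{u, w} P.V) n) :=
  DGVect.affPart.{u, w} P.V n ⊓
    (DGVect.addUnit.{u, w} P.V).mapsInto
      (DGVect.withUnit.{u, w} P.V P.F) (DGVect.withoutUnit.{u, w} P.V P.F) n

lemma δ_mem_affPart (P : DGPair.{u, max w u} K) (i j : ℤ) :
    ∀ x ∈ affPart.{u, w} P i, δ i j x ∈ affPart.{u, w} P j :=
  fun _ hx => ⟨DGVect.δ_mem_affPart.{u, w} P.V i j _ hx.1,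
    DGVect.δ_mem_affine.{u, w} P.V P.d_mem i j hx.2⟩

lemma commutator_mem_affPart (P : DGPair.{u, max w u} K) {p q r : ℤ} (h : p + q = r) :
    ∀ x ∈ affPart.{u, w} P p, ∀ y ∈ affPart.{u, w} P q,
      (DGVect.addUnit.{u, w} P.V).commutator h x y ∈ affPart.{u, w} P r :=
  fun _ hx _ hy => ⟨DGVect.commutator_mem_affPart.{u, w} P.V h _ hx.1 _ hy.1,
    DGVect.commutator_mem_affine.{u, w} P.V h hx.2 hy.2⟩

/-- The DG-Lie algebra `Aff(V; F)` of affine endomorphisms of the pair `(V, F)`. -/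
def Aff (P : DGPair.{u, max w u} K) : DGLA.{u, max w u} K :=
  (DGVect.addUnit.{u, w} P.V).End.sub (affPart.{u, w} P) (δ_mem_affPart.{u, w} P)
    (commutator_mem_affPart.{u, w} P)

/-- The inclusion `Aff(V; F) ⟶ Aff(V)`. -/
def affι (P : DGPair.{u, max w u} K) : Aff.{u, w} P ⟶ DGVect.Aff.{u, w} P.V :=
  DGLA.subLift
    (DGLA.subι (DGVect.addUnit.{u, w} P.V).End (affPart.{u, w} P)
      (δ_mem_affPart.{u, w} P) (commutator_mem_affPart.{u, w} P))
    (DGVect.affPart.{u, w} P.V) (DGVect.δ_mem_affPart.{u, w} P.V)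
    (DGVect.commutator_mem_affPart.{u, w} P.V)
    (fun n (x : affPart.{u, w} P n) => x.2.1)

/-- The canonical embedding `σ₀ : End^*(V; F) ⟶ Aff(V; F)`. -/
def sigma (P : DGPair.{u, max w u} K) : P.End ⟶ Aff.{u, w} P :=
  DGLA.subLift (P.endι ≫ DGVect.extendEnd.{u, w} P.V) (affPart.{u, w} P)
    (δ_mem_affPart.{u, w} P) (commutator_mem_affPart.{u, w} P)
    (fun n (x : P.endPart n) =>
      ⟨DGVect.extend_mem.{u, w} P.V (G := fun _ => ⊤) (ξ := x.1) fun _ _ _ _ _ => trivial,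
      DGVect.extend_mem.{u, w} P.V (ξ := x.1) x.2⟩)

/-- The Jacobian square of the pair `(V, F)`:
`End^*(V; F) → End^*(V)` on top, `Aff(V; F) → Aff(V)` at the bottom, and `σ₀` vertically. -/
def jacobianSquare (P : DGPair.{u, max w u} K) : Square (DGLA.{u, max w u} K) where
  X₁ := P.End
  X₂ := P.V.End
  X₃ := Aff.{u, w} P
  X₄ := DGVect.Aff.{u, w} P.V
  f₁₂ := P.endι
  f₁₃ := sigma.{u, w} P
  f₂₄ := DGVect.sigma.{u, w} P.V
  f₃₄ := affι.{u, w} P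
  fac := by
    apply DGLA.Hom.ext
    ext n : 1
    rfl

/-- `L` is a Jacobian DG-Lie algebra `𝔍(V, F)` of the pair `(V, F)`:
a double homotopy fiber of its Jacobian square. -/
def IsJacobian (P : DGPair.{u, max w u} K) (L : DGLA.{u, max w u} K) : Prop :=
  DGLA.IsDoubleHomotopyFiber (jacobianSquare.{u, w} P) L

end DGPair

end

/-! Two invariance statements are combined: double homotopy fibers depend only on the weak
equivalence class of a square, and homotopy equivalent pairs have weakly equivalent Jacobian
squares.

For the first, the polynomial path object M[t, dt] factors every morphism of DG-Lie algebras
functorially as a quasi-isomorphism followed by a surjection (`isWeakEquiv_mapPathι`,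
`mapPathπ_surjective`). Characteristic zero is what allows polynomials to be integrated. Factoring
the two morphisms into the last corner, and then the morphism from the first corner to the resulting
pullback, yields a functorial fibrant `resolution`. The double fiber of a fibrant square is the
kernel of a surjection onto a pullback along surjections, so a weak equivalence of fibrant squares
induces a quasi-isomorphism on it (`quasiIso_ker`, `isWeakEquiv_doubleFiberMap`).

For the second, the obstacle is that End is not functorial in V. If W deforms onto V through i, r, h
with r ∘ i = 1, however, ξ ↦ i ∘ ξ ∘ r is a morphism of DG-Lie algebras and a quasi-isomorphism
(`eq_conj_add_δ`). When i, r, h respect the subspaces, the same formula works at all four corners of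
the Jacobian square. Over a field, an injective quasi-isomorphism of pairs (V, F) → (W, G) with F
the preimage of G always extends to such a retract (`exists_deformationRetract_preserves`).

The general case is reduced to this one. A quasi-isomorphism of pairs f : P → Q is replaced by two
injective ones, P → Q × contractible(P) ← Q, given by the graph of f and the inclusion of the factor
Q. The intermediate arrows A → B of a zigzag need not be inclusions; each is replaced by its graph
inside B × contractible(A) (`ofArrow`), functorially in the arrow. -/

noncomputable section

/-! ### Quasi-isomorphisms in terms of elements -/

namespace DGVect

variable {K : Type u} [Field K] {U V W : DGVect.{u, w} K}

lemma d_d (V : DGVect.{u, w} K) (i j k : ℤ) (x : V.X i) :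
    (V.d j k).hom ((V.d i j).hom x) = 0 := by
  change (V.d i j ≫ V.d j k).hom x = 0
  rw [V.d_comp_d]; rfl

lemma f_d (f : V ⟶ W) (i j : ℤ) (x : V.X i) :
    (f.f j).hom ((V.d i j).hom x) = (W.d i j).hom ((f.f i).hom x) :=
  (LinearMap.congr_fun (congrArg ModuleCat.Hom.hom (f.comm i j)) x).symm

lemma comp_apply (f : U ⟶ V) (g : V ⟶ W) (n : ℤ) (x : U.X n) :
    ((f ≫ g).f n).hom x = (g.f n).hom ((f.f n).hom x) := rfl

lemma id_apply (n : ℤ) (x : U.X n) : (HomologicalComplex.Hom.f (𝟙 U) n).hom x = x := rfl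

/-- Surjectivity and injectivity on cohomology, spelled out on cocycles, so that later arguments can
be diagram chases or explicit homotopies. -/
lemma quasiIso_iff_elements (f : V ⟶ W) :
    QuasiIso f ↔ ∀ i j k : ℤ, i + 1 = j → j + 1 = k →
      (∀ b : W.X j, (W.d j k).hom b = 0 →
        ∃ a : V.X j, (V.d j k).hom a = 0 ∧
          ∃ b' : W.X i, b = (f.f j).hom a + (W.d i j).hom b') ∧
      (∀ a : V.X j, (V.d j k).hom a = 0 → ∀ b' : W.X i, (f.f j).hom a = (W.d i j).hom b' →
        ∃ a' : V.X i, a = (V.d i j).hom a') := by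
  have key : ∀ i j k : ℤ, i + 1 = j → j + 1 = k → (QuasiIsoAt f j ↔
      (∀ b : W.X j, (W.d j k).hom b = 0 →
        ∃ a : V.X j, (V.d j k).hom a = 0 ∧
          ∃ b' : W.X i, b = (f.f j).hom a + (W.d i j).hom b') ∧
      (∀ a : V.X j, (V.d j k).hom a = 0 → ∀ b' : W.X i, (f.f j).hom a = (W.d i j).hom b' →
        ∃ a' : V.X i, a = (V.d i j).hom a')) := by
    intro i j k hij hjk
    rw [quasiIsoAt_iff' f i j k (by simp; lia) (by simp; lia)]
    -- With the concrete left homology data, cycles are an honest kernel and cohomology is its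
    -- honest quotient by boundaries, so the induced map can be computed on representatives.
    set φ := (HomologicalComplex.shortComplexFunctor' (ModuleCat.{w} K) _ i j k).map f with hφ
    let hV := (V.sc' i j k).moduleCatLeftHomologyData
    let hW := (W.sc' i j k).moduleCatLeftHomologyData
    let γ : ShortComplex.LeftHomologyMapData φ hV hW := ShortComplex.leftHomologyMapData φ hV hW
    rw [γ.quasiIso_iff, ConcreteCategory.isIso_iff_bijective]
    obtain ⟨κ, hκ⟩ : ∃ κ : LinearMap.ker (V.d j k).hom →ₗ[K] LinearMap.ker (W.d j k).hom,
      κ = γ.φK.hom := ⟨_, rfl⟩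
    have hK : ∀ x : LinearMap.ker (V.d j k).hom, (κ x).1 = (f.f j).hom x.1 := fun x => by
      rw [hκ]
      exact LinearMap.congr_fun (congrArg ModuleCat.Hom.hom γ.commi) x
    have hπ : ∀ x : LinearMap.ker (V.d j k).hom,
        γ.φH.hom (hV.π.hom x) = hW.π.hom (κ x) := fun x => by
      rw [hκ]
      exact LinearMap.congr_fun (congrArg ModuleCat.Hom.hom γ.commπ) x
    have surjV : Function.Surjective hV.π.hom := Submodule.mkQ_surjective _
    have surjW : Function.Surjective hW.π.hom := Submodule.mkQ_surjective _
    have zeroV : ∀ x : LinearMap.ker (V.d j k).hom,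
        hV.π.hom x = 0 ↔ ∃ a' : V.X i, x.1 = (V.d i j).hom a' := by
      intro x
      refine (Submodule.Quotient.mk_eq_zero _).trans ⟨?_, ?_⟩
      · rintro ⟨a', h⟩; exact ⟨a', (congrArg Subtype.val h).symm⟩
      · rintro ⟨a', h⟩; exact ⟨a', Subtype.ext h.symm⟩
    have zeroW : ∀ x : LinearMap.ker (W.d j k).hom,
        hW.π.hom x = 0 ↔ ∃ a' : W.X i, x.1 = (W.d i j).hom a' := by
      intro x
      refine (Submodule.Quotient.mk_eq_zero _).trans ⟨?_, ?_⟩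
      · rintro ⟨a', h⟩; exact ⟨a', (congrArg Subtype.val h).symm⟩
      · rintro ⟨a', h⟩; exact ⟨a', Subtype.ext h.symm⟩
    constructor
    · rintro ⟨inj, surj⟩
      constructor
      · intro b hb
        obtain ⟨y, hy⟩ := surj (hW.π.hom (⟨b, hb⟩ : LinearMap.ker (W.d j k).hom))
        obtain ⟨x, rfl⟩ := surjV y
        refine ⟨x.1, x.2, ?_⟩
        have h1 : hW.π.hom ((⟨b, hb⟩ : LinearMap.ker (W.d j k).hom) -
            κ x) = 0 := by
          refine (map_sub hW.π.hom _ _).trans ?_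
          rw [sub_eq_zero]
          exact hy.symm.trans (hπ x)
        obtain ⟨b', h⟩ := (zeroW _).1 h1
        refine ⟨b', ?_⟩
        rw [← h, ← hK x]
        exact (add_sub_cancel (κ x).1 b).symm
      · intro a ha b' hab
        refine (zeroV ⟨a, ha⟩).1 (inj ?_)
        refine (hπ ⟨a, ha⟩).trans ((Eq.trans ?_ (map_zero γ.φH.hom).symm))
        exact (zeroW _).2 ⟨b', (hK ⟨a, ha⟩).trans hab⟩
    · rintro ⟨surj, inj⟩
      constructor
      · refine (injective_iff_map_eq_zero γ.φH.hom).2 ?_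
        intro y hy
        obtain ⟨x, rfl⟩ := surjV y
        obtain ⟨b', h⟩ := (zeroW _).1 ((hπ x).symm.trans hy)
        exact (zeroV x).2 (inj x.1 x.2 b' ((hK x).symm.trans h))
      · intro y
        obtain ⟨x, rfl⟩ := surjW y
        obtain ⟨a, ha, b', h⟩ := surj x.1 x.2
        refine ⟨hV.π.hom (⟨a, ha⟩ : LinearMap.ker (V.d j k).hom), ?_⟩
        refine (hπ _).trans (Eq.symm (sub_eq_zero.1 ?_))
        refine (map_sub hW.π.hom _ _).symm.trans
          ((zeroW ((show LinearMap.ker (W.d j k).hom from x) - κ ⟨a, ha⟩)).2 ⟨b', ?_⟩)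
        refine (congrArg (x.1 - ·) (hK ⟨a, ha⟩)).trans ?_
        rw [h]; exact add_sub_cancel_left _ _
  rw [quasiIso_iff]
  constructor
  · intro h i j k hij hjk
    exact (key i j k hij hjk).1 (h j)
  · intro h j
    exact (key (j - 1) j (j + 1) (by lia) rfl).2 (h _ _ _ (by lia) rfl)

/-- A quasi-isomorphism with a surjection on the targets of surjections induces a
quasi-isomorphism on kernels. -/
lemma quasiIso_ker {E B E' B' : DGVect.{u, w} K} {p : E ⟶ B} {p' : E' ⟶ B'} {e : E ⟶ E'}
    {b : B ⟶ B'} (comm : e ≫ p' = p ≫ b) (hp : ∀ n, Function.Surjective (p.f n).hom)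
    (hp' : ∀ n, Function.Surjective (p'.f n).hom) [QuasiIso e] [QuasiIso b]
    {A : ∀ n, Submodule K (E.X n)} {A' : ∀ n, Submodule K (E'.X n)}
    (hA : ∀ i j, ∀ x ∈ A i, (E.d i j).hom x ∈ A j)
    (hA' : ∀ i j, ∀ x ∈ A' i, (E'.d i j).hom x ∈ A' j)
    (mem : ∀ n x, x ∈ A n ↔ (p.f n).hom x = 0) (mem' : ∀ n x, x ∈ A' n ↔ (p'.f n).hom x = 0)
    (k : E.sub A hA ⟶ E'.sub A' hA')
    (hk : ∀ n (x : A n), (E'.subι A' hA' |>.f n).hom ((k.f n).hom x) = (e.f n).hom x.1) :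
    QuasiIso k := by
  have comm' : ∀ n (x : E.X n), (p'.f n).hom ((e.f n).hom x) = (b.f n).hom ((p.f n).hom x) :=
    fun n x => LinearMap.congr_fun
      (congrArg (fun t : E ⟶ B' => (HomologicalComplex.Hom.f t n).hom) comm) x
  have he := (quasiIso_iff_elements e).1 inferInstance
  have hb := (quasiIso_iff_elements b).1 inferInstance
  rw [quasiIso_iff_elements]
  intro i j l hij hjl
  constructor
  · rintro ⟨x', hx'⟩ hdx'
    replace hdx' : (E'.d j l).hom x' = 0 := congrArg Subtype.val hdx'
    -- The cocycle is e x + d y', but x and y' need not lie in the kernels. Since b (p x) = -d (p'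
    -- y'), the cocycle p x is a boundary d (p v), which permits correcting x to x - d v and y' to
    -- y' + e v.
    obtain ⟨x, hx, y', rfl⟩ := (he i j l hij hjl).1 x' hdx'
    rw [mem', map_add, comm', f_d] at hx'
    obtain ⟨z, hz⟩ := (hb i j l hij hjl).2 ((p.f j).hom x) (by rw [← f_d, hx, map_zero])
      (-(p'.f i).hom y') (by rw [map_neg]; exact eq_neg_of_add_eq_zero_left hx')
    obtain ⟨v, rfl⟩ := hp i z
    -- The corrected y' still maps to a possibly nonzero cocycle of B'. Its class comes from B, and
    -- lifting the representative and the boundary term to s and s' removes it.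
    have h1 : (B'.d i j).hom ((p'.f i).hom (y' + (e.f i).hom v)) = 0 := by
      rw [map_add, map_add, comm', ← f_d b, ← hz, add_comm, hx']
    obtain ⟨c, hc, c', hcc⟩ := (hb (i - 1) i j (by lia) hij).1 _ h1
    obtain ⟨s, rfl⟩ := hp i c
    obtain ⟨s', rfl⟩ := hp' (i - 1) c'
    refine ⟨⟨x - (E.d i j).hom v + (E.d i j).hom s, ?_⟩, ?_,
      ⟨y' + (e.f i).hom v - (e.f i).hom s - (E'.d (i - 1) i).hom s', ?_⟩, ?_⟩
    · rw [mem, map_add, map_sub, f_d, f_d, hz, hc]; simp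
    · apply Subtype.ext
      change (E.d j l).hom (x - (E.d i j).hom v + (E.d i j).hom s) = 0
      simp [d_d, hx]
    · rw [mem', map_sub, map_sub, hcc, comm', f_d]; abel
    · apply Subtype.ext
      refine Eq.trans ?_ (congrArg (· + (E'.d i j).hom
        (y' + (e.f i).hom v - (e.f i).hom s - (E'.d (i - 1) i).hom s')) (hk j _).symm)
      simp only [map_add, map_sub, f_d, d_d]
      abel
  · rintro ⟨x, hx⟩ hdx ⟨k', hk₁⟩ hkk
    replace hdx : (E.d j l).hom x = 0 := congrArg Subtype.val hdx
    have h1 := congrArg Subtype.val hkk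
    replace h1 : (e.f j).hom x = (E'.d i j).hom k' := (hk j ⟨x, hx⟩).symm.trans h1
    -- The primitive y is adjusted twice: by a cocycle v, so that e (y - v) agrees with k' up to a
    -- boundary, which makes p (y - v) a boundary; then by d s, to bring it into the kernel.
    obtain ⟨y, rfl⟩ := (he i j l hij hjl).2 x hdx k' h1
    obtain ⟨v, hv, w', hw⟩ := (he (i - 1) i j (by lia) hij).1 ((e.f i).hom y - k')
      (by rw [map_sub, ← h1, f_d, sub_self])
    have hy : (B.d i j).hom ((p.f i).hom (y - v)) = 0 := by
      rw [← f_d, map_sub, hv, sub_zero]; exact (mem _ _).1 hx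
    obtain ⟨z, hz⟩ := (hb (i - 1) i j (by lia) hij).2 _ hy ((p'.f (i - 1)).hom w') (by
      have h3 : (e.f i).hom (y - v) = k' + (E'.d (i - 1) i).hom w' := by
        rw [map_sub, ← sub_eq_zero]
        rw [← sub_eq_zero] at hw
        rw [← hw]; abel
      rw [← comm', h3, map_add, (mem' _ _).1 hk₁, zero_add, f_d])
    obtain ⟨s, rfl⟩ := hp (i - 1) z
    refine ⟨⟨y - v - (E.d (i - 1) i).hom s, ?_⟩, ?_⟩
    · rw [mem, map_sub, hz, f_d, sub_self]
    · apply Subtype.ext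
      change _ = (E.d i j).hom _
      simp [d_d, hv]

end DGVect

/-! ### Polynomials with coefficients in a vector space -/

namespace VectorPolynomial

variable {K : Type*} [Field K] {A B C D E F : Type*}
  [AddCommGroup A] [Module K A] [AddCommGroup B] [Module K B] [AddCommGroup C] [Module K C]
  [AddCommGroup D] [Module K D] [AddCommGroup E] [Module K E] [AddCommGroup F] [Module K F]

/-- The coefficientwise extension of a linear map to polynomials. -/
def map (f : A →ₗ[K] B) : (ℕ →₀ A) →ₗ[K] (ℕ →₀ B) := Finsupp.mapRange.linearMap f

/-- The extension of a bilinear map to polynomials. -/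
def map₂ (β : A →ₗ[K] B →ₗ[K] C) : (ℕ →₀ A) →ₗ[K] (ℕ →₀ B) →ₗ[K] (ℕ →₀ C) :=
  Finsupp.lsum K fun a => LinearMap.flip <|
    Finsupp.lsum K fun b => LinearMap.flip (β.compr₂ (Finsupp.lsingle (a + b)))

/-- The derivative. -/
def deriv (K A : Type*) [Field K] [AddCommGroup A] [Module K A] : (ℕ →₀ A) →ₗ[K] (ℕ →₀ A) :=
  -- The truncated exponent at `a = 0` is harmless, since its coefficient is zero.
  Finsupp.lsum K fun a => (a : K) • Finsupp.lsingle (a - 1)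

/-- The primitive without constant term. -/
def integral (K A : Type*) [Field K] [AddCommGroup A] [Module K A] : (ℕ →₀ A) →ₗ[K] (ℕ →₀ A) :=
  Finsupp.lsum K fun a => ((a + 1 : ℕ) : K)⁻¹ • Finsupp.lsingle (a + 1)

/-- The value at `0`. -/
def evalZero (K A : Type*) [Field K] [AddCommGroup A] [Module K A] : (ℕ →₀ A) →ₗ[K] A :=
  Finsupp.lapply 0

/-- The value at `1`. -/
def evalOne (K A : Type*) [Field K] [AddCommGroup A] [Module K A] : (ℕ →₀ A) →ₗ[K] A :=
  Finsupp.lsum K fun _ => LinearMap.id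

/-- Constant polynomials. -/
def const (K A : Type*) [Field K] [AddCommGroup A] [Module K A] : A →ₗ[K] (ℕ →₀ A) :=
  Finsupp.lsingle 0

@[simp]
lemma map_single (f : A →ₗ[K] B) (n : ℕ) (x : A) :
    map f (Finsupp.single n x) = Finsupp.single n (f x) := by simp [map]

@[simp]
lemma map₂_single (β : A →ₗ[K] B →ₗ[K] C) (m n : ℕ) (x : A) (y : B) :
    map₂ β (Finsupp.single m x) (Finsupp.single n y) = Finsupp.single (m + n) (β x y) := by
  simp [map₂]

@[simp]
lemma deriv_single (n : ℕ) (x : A) :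
    deriv K A (Finsupp.single n x) = (n : K) • Finsupp.single (n - 1) x := by simp [deriv]

@[simp]
lemma integral_single (n : ℕ) (x : A) :
    integral K A (Finsupp.single n x) = ((n + 1 : ℕ) : K)⁻¹ • Finsupp.single (n + 1) x := by
  simp [integral]

@[simp]
lemma evalOne_single (n : ℕ) (x : A) : evalOne K A (Finsupp.single n x) = x := by simp [evalOne]

lemma evalZero_single (n : ℕ) (x : A) :
    evalZero K A (Finsupp.single n x) = if n = 0 then x else 0 := by
  simp [evalZero, Finsupp.single_apply]

@[simp]
lemma evalZero_const (x : A) : evalZero K A (const K A x) = x := by simp [evalZero, const]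

@[simp]
lemma evalOne_const (x : A) : evalOne K A (const K A x) = x := by simp [const]

@[simp]
lemma map_const (f : A →ₗ[K] B) (x : A) : map f (const K A x) = const K B (f x) := by
  simp [const]

@[simp]
lemma deriv_const (x : A) : deriv K A (const K A x) = 0 := by simp [const]

lemma map₂_const (β : A →ₗ[K] B →ₗ[K] C) (x : A) (y : B) :
    map₂ β (const K A x) (const K B y) = const K C (β x y) := by simp [const]

lemma map_id (x : ℕ →₀ A) : map (LinearMap.id : A →ₗ[K] A) x = x := by
  simp [map]

lemma map_map (f : A →ₗ[K] B) (g : B →ₗ[K] C) (x : ℕ →₀ A) :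
    map g (map f x) = map (g ∘ₗ f) x := by
  induction x using Finsupp.induction_linear <;> simp_all

lemma map_zero_left (x : ℕ →₀ A) : map (0 : A →ₗ[K] B) x = 0 := by
  induction x using Finsupp.induction_linear <;> simp_all

lemma evalZero_map (f : A →ₗ[K] B) (x : ℕ →₀ A) :
    evalZero K B (map f x) = f (evalZero K A x) := by simp [evalZero, map]

lemma evalOne_map (f : A →ₗ[K] B) (x : ℕ →₀ A) :
    evalOne K B (map f x) = f (evalOne K A x) := by
  induction x using Finsupp.induction_linear <;> simp_all

lemma deriv_map (f : A →ₗ[K] B) (x : ℕ →₀ A) :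
    deriv K B (map f x) = map f (deriv K A x) := by
  induction x using Finsupp.induction_linear <;> simp_all

lemma integral_map (f : A →ₗ[K] B) (x : ℕ →₀ A) :
    integral K B (map f x) = map f (integral K A x) := by
  induction x using Finsupp.induction_linear <;> simp_all

lemma evalZero_integral (x : ℕ →₀ A) : evalZero K A (integral K A x) = 0 := by
  induction x using Finsupp.induction_linear <;> simp_all [evalZero_single]

/-- Here and in `integral_deriv`, the two halves of the fundamental theorem of calculus, lies the
only use of characteristic zero: n + 1 must be invertible. -/
lemma deriv_integral [CharZero K] (x : ℕ →₀ A) : deriv K A (integral K A x) = x := by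
  induction x using Finsupp.induction_linear with
  | zero => simp
  | add f g hf hg => simp [hf, hg]
  | single n x =>
    have : ((n : K) + 1) ≠ 0 := by exact_mod_cast n.succ_ne_zero
    simp [smul_smul, this]

lemma integral_deriv [CharZero K] (x : ℕ →₀ A) :
    integral K A (deriv K A x) = x - const K A (evalZero K A x) := by
  induction x using Finsupp.induction_linear with
  | zero => simp
  | add f g hf hg => simp only [map_add, hf, hg]; abel
  | single n x =>
    cases n with
    | zero => simp [const, evalZero_single]
    | succ n =>
      have : ((n : K) + 1) ≠ 0 := by exact_mod_cast n.succ_ne_zero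
      simp [smul_smul, this, evalZero_single]

lemma evalOne_map₂ (β : A →ₗ[K] B →ₗ[K] C) (x : ℕ →₀ A) (y : ℕ →₀ B) :
    evalOne K C (map₂ β x y) = β (evalOne K A x) (evalOne K B y) := by
  induction x using Finsupp.induction_linear with
  | zero => simp
  | add f g hf hg => simp [hf, hg]
  | single m x => induction y using Finsupp.induction_linear <;> simp_all

lemma evalZero_map₂ (β : A →ₗ[K] B →ₗ[K] C) (x : ℕ →₀ A) (y : ℕ →₀ B) :
    evalZero K C (map₂ β x y) = β (evalZero K A x) (evalZero K B y) := by
  induction x using Finsupp.induction_linear with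
  | zero => simp
  | add f g hf hg => simp [hf, hg]
  | single m x =>
    induction y using Finsupp.induction_linear with
    | zero => simp
    | add f g hf hg => simp [hf, hg]
    | single n y =>
      simp only [map₂_single, evalZero_single]
      by_cases hm : m = 0 <;> by_cases hn : n = 0 <;> simp [hm, hn]

lemma deriv_map₂ (β : A →ₗ[K] B →ₗ[K] C) (x : ℕ →₀ A) (y : ℕ →₀ B) :
    deriv K C (map₂ β x y) = map₂ β (deriv K A x) y + map₂ β x (deriv K B y) := by
  induction x using Finsupp.induction_linear with
  | zero => simp
  | add f g hf hg => simp only [map_add, LinearMap.add_apply, hf, hg]; abel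
  | single m x =>
    induction y using Finsupp.induction_linear with
    | zero => simp
    | add f g hf hg => simp only [map_add, hf, hg]; abel
    | single n y =>
      -- Constants are separated because the exponents m - 1 and n - 1 are truncated there;
      -- otherwise both products on the right have exponent m + n - 1.
      rcases m with _ | m <;> rcases n with _ | n
      · simp
      · simp
      · simp
      · have e₁ : m + 1 + (n + 1) - 1 = m + n + 1 := by omega
        have e₂ : m + (n + 1) = m + n + 1 := by omega
        have e₃ : m + 1 + n = m + n + 1 := by omega
        simp [e₁, e₂, e₃, ← Finsupp.single_add, ← add_smul]

lemma map_map₂ (β : A →ₗ[K] B →ₗ[K] C) (β' : D →ₗ[K] E →ₗ[K] F) (f : A →ₗ[K] D)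
    (g : B →ₗ[K] E) (h : C →ₗ[K] F) (H : ∀ x y, h (β x y) = β' (f x) (g y))
    (x : ℕ →₀ A) (y : ℕ →₀ B) : map h (map₂ β x y) = map₂ β' (map f x) (map g y) := by
  induction x using Finsupp.induction_linear with
  | zero => simp
  | add f g hf hg => simp [hf, hg]
  | single m x => induction y using Finsupp.induction_linear <;> simp_all

lemma map₂_skew (β : A →ₗ[K] B →ₗ[K] C) (β' : B →ₗ[K] A →ₗ[K] C) (ε : ℤˣ)
    (H : ∀ x y, β x y = -(ε • β' y x)) (x : ℕ →₀ A) (y : ℕ →₀ B) :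
    map₂ β x y = -(ε • map₂ β' y x) := by
  induction x using Finsupp.induction_linear with
  | zero => simp
  | add f g hf hg => simp only [map_add, LinearMap.add_apply, hf, hg, smul_add]; abel
  | single m x =>
    induction y using Finsupp.induction_linear with
    | zero => simp
    | add f g hf hg => simp only [map_add, LinearMap.add_apply, hf, hg, smul_add]; abel
    | single n y =>
      obtain rfl | rfl := Int.units_eq_one_or ε <;> simp [H, add_comm n m]

lemma map₂_jacobi {X : Type*} [AddCommGroup X] [Module K X]
    (β₁ : A →ₗ[K] D →ₗ[K] X) (β₂ : B →ₗ[K] C →ₗ[K] D) (β₃ : E →ₗ[K] C →ₗ[K] X)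
    (β₄ : A →ₗ[K] B →ₗ[K] E) (β₅ : B →ₗ[K] F →ₗ[K] X) (β₆ : A →ₗ[K] C →ₗ[K] F) (ε : ℤˣ)
    (H : ∀ x y z, β₁ x (β₂ y z) = β₃ (β₄ x y) z + ε • β₅ y (β₆ x z))
    (x : ℕ →₀ A) (y : ℕ →₀ B) (z : ℕ →₀ C) :
    map₂ β₁ x (map₂ β₂ y z) =
      map₂ β₃ (map₂ β₄ x y) z + ε • map₂ β₅ y (map₂ β₆ x z) := by
  induction x using Finsupp.induction_linear with
  | zero => simp
  | add f g hf hg => simp only [map_add, LinearMap.add_apply, hf, hg, smul_add]; abel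
  | single m x =>
    induction y using Finsupp.induction_linear with
    | zero => simp
    | add f g hf hg => simp only [map_add, LinearMap.add_apply, hf, hg, smul_add]; abel
    | single n y =>
      induction z using Finsupp.induction_linear with
      | zero => simp
      | add f g hf hg => simp only [map_add, hf, hg, smul_add]; abel
      | single l z =>
        have e : n + (m + l) = m + (n + l) := by omega
        obtain rfl | rfl := Int.units_eq_one_or ε <;>
          simp [H, e, add_assoc, Finsupp.single_add, Finsupp.single_neg]

lemma map₂_leibniz {X : Type*} [AddCommGroup X] [Module K X]
    (β₁ : A →ₗ[K] B →ₗ[K] C) (β₂ : D →ₗ[K] B →ₗ[K] X) (β₃ : A →ₗ[K] E →ₗ[K] X)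
    (f : A →ₗ[K] D) (g : B →ₗ[K] E) (h : C →ₗ[K] X) (ε : ℤˣ)
    (H : ∀ x y, h (β₁ x y) = β₂ (f x) y + ε • β₃ x (g y)) (x : ℕ →₀ A) (y : ℕ →₀ B) :
    map h (map₂ β₁ x y) = map₂ β₂ (map f x) y + ε • map₂ β₃ x (map g y) := by
  induction x using Finsupp.induction_linear with
  | zero => simp
  | add f g hf hg => simp only [map_add, LinearMap.add_apply, hf, hg, smul_add]; abel
  | single m x =>
    induction y using Finsupp.induction_linear with
    | zero => simp
    | add f g hf hg => simp only [map_add, hf, hg, smul_add]; abel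
    | single n y =>
      obtain rfl | rfl := Int.units_eq_one_or ε <;>
        simp [H, Finsupp.single_add, Finsupp.single_neg]

end VectorPolynomial

/-! ### Identifications between components in equal degrees. -/

namespace DGVect

variable {K : Type u} [Field K]

/-- The identification of two components of equal degrees, zero for distinct degrees. -/
def castX (V : DGVect.{u, w} K) (i j : ℤ) : V.X i →ₗ[K] V.X j :=
  if h : i = j then (V.XIsoOfEq h).hom.hom else 0

@[simp]
lemma castX_self (V : DGVect.{u, w} K) (i : ℤ) : V.castX i i = LinearMap.id := by
  simp [castX]

lemma castX_of_ne (V : DGVect.{u, w} K) {i j : ℤ} (h : i ≠ j) : V.castX i j = 0 := by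
  simp [castX, h]

lemma castX_castX (V : DGVect.{u, w} K) {i j : ℤ} (h : i = j) :
    V.castX j i ∘ₗ V.castX i j = LinearMap.id := by
  subst h; simp

lemma castX_d (V : DGVect.{u, w} K) {i j i' j' : ℤ} (h : i = j) (h' : i' = j') (x : V.X i) :
    V.castX i' j' ((V.d i i').hom x) = (V.d j j').hom (V.castX i j x) := by
  subst h h'; simp

lemma castX_f {V W : DGVect.{u, w} K} (f : V ⟶ W) (i j : ℤ) (x : V.X i) :
    W.castX i j ((f.f i).hom x) = (f.f j).hom (V.castX i j x) := by
  by_cases h : i = j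
  · subst h; simp
  · simp [castX_of_ne _ h]

end DGVect

/-! ### The DG-Lie algebra M[t, dt]. -/

namespace DGLA

variable {K : Type u} [Field K]

open VectorPolynomial

lemma castX_bracket_left (M : DGLA.{u, w} K) {p q r m s : ℤ} (h : p + q = r) (h' : m + q = s)
    (hp : p = m) (x : M.cx.X p) (y : M.cx.X q) :
    M.cx.castX r s (M.bracket h x y) = M.bracket h' (M.cx.castX p m x) y := by
  subst hp h h'; simp

lemma castX_bracket_right (M : DGLA.{u, w} K) {p q r m s : ℤ} (h : p + q = r) (h' : p + m = s)
    (hq : q = m) (x : M.cx.X p) (y : M.cx.X q) :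
    M.cx.castX r s (M.bracket h x y) = M.bracket h' x (M.cx.castX q m y) := by
  subst hq h h'; simp

/-- The underlying complex of `M[t, dt]`: in degree `n`, the pairs `(x, ω)` of polynomials with
coefficients in degrees `n` and `n - 1`, standing for `x + ω dt`. -/
def pathCx (V : DGVect.{u, w} K) : DGVect.{u, w} K where
  X n := ModuleCat.of K ((ℕ →₀ V.X n) × (ℕ →₀ V.X (n - 1)))
  d i j := ModuleCat.ofHom <| LinearMap.prod
    (map (V.d i j).hom ∘ₗ LinearMap.fst K _ _)
    -- As dt is written on the right, d (x tᵃ) = (dx) tᵃ + (-1)^{|x|} a x tᵃ⁻¹ dt. The cast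
    -- identifies degree i with j - 1.
    (i.negOnePow • (map (V.castX i (j - 1)) ∘ₗ deriv K _) ∘ₗ LinearMap.fst K _ _ +
      map (V.d (i - 1) (j - 1)).hom ∘ₗ LinearMap.snd K _ _)
  shape i j hij := by
    have h₁ : i ≠ j - 1 := by rintro rfl; exact hij (by simp)
    have h₂ : ¬ (ComplexShape.up ℤ).Rel (i - 1) (j - 1) := by
      intro h; apply hij; simp at h ⊢; lia
    apply ModuleCat.hom_ext
    refine LinearMap.ext fun x => Prod.ext ?_ ?_
    · simp [V.shape i j hij, map_zero_left]
    · simp [V.shape _ _ h₂, map_zero_left, V.castX_of_ne h₁]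
  d_comp_d' i j k hij hjk := by
    simp only [ComplexShape.up_Rel] at hij hjk
    have hd : ∀ i j k : ℤ, (V.d j k).hom ∘ₗ (V.d i j).hom = 0 := fun i j k =>
      LinearMap.ext (V.d_d i j k)
    have hc : (V.d (j - 1) (k - 1)).hom ∘ₗ V.castX i (j - 1) =
        V.castX j (k - 1) ∘ₗ (V.d i j).hom :=
      LinearMap.ext fun x => (V.castX_d (by lia) (by lia) x).symm
    apply ModuleCat.hom_ext
    refine LinearMap.ext fun x => Prod.ext ?_ ?_
    · simp [map_map, hd, map_zero_left]
    -- The two mixed terms, the derivative of dx and the differential of the derivative of x, carry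
    -- the opposite signs (-1)^{i+1} and (-1)^i.
    · obtain rfl := hij
      obtain e | e := Int.units_eq_one_or i.negOnePow <;>
      simp [map_map, hd, map_zero_left, deriv_map, hc, Int.negOnePow_succ, e]

lemma pathCx_d_fst (V : DGVect.{u, w} K) (i j : ℤ) (x : (pathCx V).X i) :
    Prod.fst (((pathCx V).d i j).hom x) = map (V.d i j).hom (Prod.fst x) := rfl

lemma pathCx_d_snd (V : DGVect.{u, w} K) (i j : ℤ) (x : (pathCx V).X i) :
    Prod.snd (((pathCx V).d i j).hom x) =
      i.negOnePow • map (V.castX i (j - 1)) (deriv K _ (Prod.fst x)) +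
        map (V.d (i - 1) (j - 1)).hom (Prod.snd x) := rfl

/-- The bracket of `M[t, dt]`. -/
def pathBracket (M : DGLA.{u, w} K) {p q r : ℤ} (h : p + q = r) :
    (pathCx M.cx).X p →ₗ[K] (pathCx M.cx).X q →ₗ[K] (pathCx M.cx).X r :=
  let β : (ℕ →₀ M.cx.X p) × (ℕ →₀ M.cx.X (p - 1)) →ₗ[K]
      (ℕ →₀ M.cx.X q) × (ℕ →₀ M.cx.X (q - 1)) →ₗ[K] (ℕ →₀ M.cx.X r) × (ℕ →₀ M.cx.X (r - 1)) :=
    LinearMap.mk₂ K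
      -- Moving dt to the right past y of degree q costs (-1)^q, and dt² = 0 leaves no other terms.
      (fun x y => (map₂ (M.bracket h) x.1 y.1,
        map₂ (M.bracket (by lia : p + (q - 1) = r - 1)) x.1 y.2 +
          q.negOnePow • map₂ (M.bracket (by lia : (p - 1) + q = r - 1)) x.2 y.1))
      (fun x x' y => Prod.ext (by simp) (by simp; abel))
      (fun c x y => Prod.ext (by simp) (by simp [smul_comm _ c]))
      (fun x y y' => Prod.ext (by simp) (by simp; abel))
      (fun c x y => Prod.ext (by simp) (by simp [smul_comm _ c]))
  β

lemma pathBracket_fst (M : DGLA.{u, w} K) {p q r : ℤ} (h : p + q = r)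
    (x : (pathCx M.cx).X p) (y : (pathCx M.cx).X q) :
    Prod.fst (M.pathBracket h x y) = map₂ (M.bracket h) (Prod.fst x) (Prod.fst y) := rfl

lemma pathBracket_snd (M : DGLA.{u, w} K) {p q r : ℤ} (h : p + q = r)
    (x : (pathCx M.cx).X p) (y : (pathCx M.cx).X q) :
    Prod.snd (M.pathBracket h x y) =
      map₂ (M.bracket (by lia : p + (q - 1) = r - 1)) (Prod.fst x) (Prod.snd y) +
        q.negOnePow •
          map₂ (M.bracket (by lia : (p - 1) + q = r - 1)) (Prod.snd x) (Prod.fst y) := rfl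

/-- Sign bookkeeping for `pathBracket_jacobi_snd`, where a, b, c, d are (-1)^{pq}, (-1)^p, (-1)^q,
(-1)^r and the tᵢ are the six iterated brackets on the right-hand side. -/
lemma jacobi_signs {X : Type*} [AddCommGroup X] (t₁ t₂ t₃ t₄ t₅ t₆ : X) (a b c d : ℤˣ) :
    t₁ + (a : ℤ) • t₂ + (d : ℤ) • (t₃ + ((a * b : ℤˣ) : ℤ) • t₄) +
        ((c * d : ℤˣ) : ℤ) • (t₅ + ((a * c : ℤˣ) : ℤ) • t₆) =
      t₁ + (d : ℤ) • (t₃ + (c : ℤ) • t₅) +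
        (a : ℤ) • (t₂ + (d : ℤ) • t₆ + ((b * d : ℤˣ) : ℤ) • t₄) := by
  obtain rfl | rfl := Int.units_eq_one_or a <;> obtain rfl | rfl := Int.units_eq_one_or b <;>
  obtain rfl | rfl := Int.units_eq_one_or c <;> obtain rfl | rfl := Int.units_eq_one_or d <;>
  simp <;> abel

/-- The dt-coefficient of the Jacobi identity. Every term contains exactly one of x', y', z', so it
is the sum of three instances of the Jacobi identity of M, with one degree lowered by 1 in each. -/
lemma pathBracket_jacobi_snd (M : DGLA.{u, w} K) {p q r pq qr pr s : ℤ} (hpq : p + q = pq)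
    (hqr : q + r = qr) (hpr : p + r = pr) (h₁ : p + qr = s) (h₂ : pq + r = s) (h₃ : q + pr = s)
    (x : ℕ →₀ M.cx.X p) (x' : ℕ →₀ M.cx.X (p - 1)) (y : ℕ →₀ M.cx.X q)
    (y' : ℕ →₀ M.cx.X (q - 1)) (z : ℕ →₀ M.cx.X r) (z' : ℕ →₀ M.cx.X (r - 1)) :
    map₂ (M.bracket (by lia : p + (qr - 1) = s - 1)) x
        (map₂ (M.bracket (by lia : q + (r - 1) = qr - 1)) y z' +
          r.negOnePow • map₂ (M.bracket (by lia : (q - 1) + r = qr - 1)) y' z) +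
        qr.negOnePow • map₂ (M.bracket (by lia : (p - 1) + qr = s - 1)) x'
          (map₂ (M.bracket hqr) y z) =
      map₂ (M.bracket (by lia : pq + (r - 1) = s - 1)) (map₂ (M.bracket hpq) x y) z' +
        r.negOnePow • map₂ (M.bracket (by lia : (pq - 1) + r = s - 1))
          (map₂ (M.bracket (by lia : p + (q - 1) = pq - 1)) x y' +
            q.negOnePow • map₂ (M.bracket (by lia : (p - 1) + q = pq - 1)) x' y) z +
      (p * q).negOnePow • (map₂ (M.bracket (by lia : q + (pr - 1) = s - 1)) y
        (map₂ (M.bracket (by lia : p + (r - 1) = pr - 1)) x z' +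
          r.negOnePow • map₂ (M.bracket (by lia : (p - 1) + r = pr - 1)) x' z) +
        pr.negOnePow • map₂ (M.bracket (by lia : (q - 1) + pr = s - 1)) y'
          (map₂ (M.bracket hpr) x z)) := by
  have j₁ := map₂_jacobi _ _ _ _ _ _ _ (M.jacobi hpq (by lia : q + (r - 1) = qr - 1)
    (by lia : p + (r - 1) = pr - 1) (by lia : _ = s - 1) (by lia) (by lia)) x y z'
  have j₂ := map₂_jacobi _ _ _ _ _ _ _ (M.jacobi (by lia : p + (q - 1) = pq - 1)
    (by lia : (q - 1) + r = qr - 1) hpr (by lia : _ = s - 1) (by lia) (by lia)) x y' z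
  have j₃ := map₂_jacobi _ _ _ _ _ _ _ (M.jacobi (by lia : (p - 1) + q = pq - 1)
    hqr (by lia : (p - 1) + r = pr - 1) (by lia : _ = s - 1) (by lia) (by lia)) x' y z
  have e₁ : (p * (q - 1)).negOnePow = (p * q).negOnePow * p.negOnePow := by
    rw [mul_sub, mul_one, Int.negOnePow_sub]
  have e₂ : ((p - 1) * q).negOnePow = (p * q).negOnePow * q.negOnePow := by
    rw [sub_mul, one_mul, Int.negOnePow_sub]
  have e₃ : qr.negOnePow = q.negOnePow * r.negOnePow := by rw [← hqr, Int.negOnePow_add]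
  have e₄ : pr.negOnePow = p.negOnePow * r.negOnePow := by rw [← hpr, Int.negOnePow_add]
  rw [e₁] at j₂
  rw [e₂] at j₃
  simp only [map_add, LinearMap.add_apply, Units.smul_def, map_zsmul, LinearMap.smul_apply, e₃, e₄]
    at j₁ j₂ j₃ ⊢
  rw [j₁, j₂, j₃]
  exact jacobi_signs _ _ _ _ _ _ _ _ _ _

/-- The path object `M[t, dt]` of a DG-Lie algebra. -/
def path (M : DGLA.{u, w} K) : DGLA.{u, w} K where
  cx := pathCx M.cx
  bracket h := M.pathBracket h
  skew {p q r} h h' x y := by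
    refine Prod.ext (map₂_skew _ _ _ (M.skew h h') _ _) ?_
    change _ = -((p * q).negOnePow • Prod.snd (M.pathBracket h' y x))
    rw [pathBracket_snd, pathBracket_snd,
      map₂_skew _ _ _ (M.skew (by lia : p + (q - 1) = r - 1) (by lia : (q - 1) + p = r - 1)),
      map₂_skew _ _ _ (M.skew (by lia : (p - 1) + q = r - 1) (by lia : q + (p - 1) = r - 1))]
    have e₁ : (p * (q - 1)).negOnePow = (p * q).negOnePow * p.negOnePow := by
      rw [mul_sub, mul_one, Int.negOnePow_sub]
    have e₂ : ((p - 1) * q).negOnePow = (p * q).negOnePow * q.negOnePow := by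
      rw [sub_mul, one_mul, Int.negOnePow_sub]
    rw [e₁, e₂]
    obtain f₁ | f₁ := Int.units_eq_one_or (p * q).negOnePow <;>
    obtain f₂ | f₂ := Int.units_eq_one_or p.negOnePow <;>
    obtain f₃ | f₃ := Int.units_eq_one_or q.negOnePow <;>
    simp [f₁, f₂, f₃]
  jacobi {p q r pq qr pr s} hpq hqr hpr h₁ h₂ h₃ x y z := by
    refine Prod.ext (map₂_jacobi _ _ _ _ _ _ _ (M.jacobi hpq hqr hpr h₁ h₂ h₃) _ _ _) ?_
    change _ = Prod.snd (M.pathBracket h₂ (M.pathBracket hpq x y) z) +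
      (p * q).negOnePow • Prod.snd (M.pathBracket h₃ y (M.pathBracket hpr x z))
    exact M.pathBracket_jacobi_snd hpq hqr hpr h₁ h₂ h₃ _ _ _ _ _ _
  leibniz {p q r p' q' r'} h hr h₁ h₂ x y := by
    refine Prod.ext (map₂_leibniz _ _ _ _ _ _ _ (M.leibniz h hr h₁ h₂) _ _) ?_
    change _ = Prod.snd (M.pathBracket h₁ (((pathCx M.cx).d p p').hom x) y) +
      p.negOnePow • Prod.snd (M.pathBracket h₂ x (((pathCx M.cx).d q q').hom y))
    rw [pathCx_d_snd, pathBracket_snd, pathBracket_snd]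
    simp only [pathBracket_snd, pathBracket_fst, pathCx_d_snd, pathCx_d_fst, deriv_map₂,
      map_add, LinearMap.add_apply]
    -- The dt-coefficient splits in two: the differential of M acting on the mixed brackets (`l₁`,
    -- `l₂`), and the product rule for the t-derivative of the bracket (`c₁`, `c₂`).
    have l₁ := map₂_leibniz _ _ _ _ _ _ _ (M.leibniz (by lia : p + (q - 1) = r - 1)
      (by lia : _ = r' - 1) (by lia : p' + (q - 1) = _) (by lia : p + (q' - 1) = _))
      (Prod.fst x) (Prod.snd y)
    have l₂ := map₂_leibniz _ _ _ _ _ _ _ (M.leibniz (by lia : (p - 1) + q = r - 1)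
      (by lia : _ = r' - 1) (by lia : (p' - 1) + q = _) (by lia : (p - 1) + q' = _))
      (Prod.snd x) (Prod.fst y)
    have c₁ := map_map₂ (M.bracket h) (M.bracket (by lia : (p' - 1) + q = r' - 1))
      (M.cx.castX p (p' - 1)) LinearMap.id (M.cx.castX r (r' - 1))
      (fun a b => M.castX_bracket_left h _ (by lia) a b) (deriv K _ (Prod.fst x)) (Prod.fst y)
    have c₂ := map_map₂ (M.bracket h) (M.bracket (by lia : p + (q' - 1) = r' - 1))
      LinearMap.id (M.cx.castX q (q' - 1)) (M.cx.castX r (r' - 1))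
      (fun a b => M.castX_bracket_right h _ (by lia) a b) (Prod.fst x) (deriv K _ (Prod.fst y))
    rw [map_id] at c₁ c₂
    have e₁ : (p - 1).negOnePow = - p.negOnePow := by
      rw [Int.negOnePow_sub]; simp
    have e₂ : q'.negOnePow = - q.negOnePow := by
      rw [← (by lia : q + 1 = q'), Int.negOnePow_succ]
    have e₃ : r.negOnePow = p.negOnePow * q.negOnePow := by rw [← h, Int.negOnePow_add]
    rw [e₁] at l₂
    rw [e₂, e₃, c₁, c₂]
    obtain f₂ | f₂ := Int.units_eq_one_or p.negOnePow <;>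
    obtain f₃ | f₃ := Int.units_eq_one_or q.negOnePow <;>
    simp [f₂, f₃] at l₁ l₂ ⊢ <;> rw [l₁, l₂] <;> abel

end DGLA

/-! ### Morphisms of DG-Lie algebras through their components. -/

namespace DGLA

variable {K : Type u} [Field K] {L M N L' M' N' : DGLA.{u, w} K}

open VectorPolynomial

/-- The components of a morphism of DG-Lie algebras. -/
abbrev app (f : L ⟶ M) (n : ℤ) : L.cx.X n →ₗ[K] M.cx.X n := ((Hom.hom f).f n).hom

lemma comp_app (f : L ⟶ M) (g : M ⟶ N) (n : ℤ) (x : L.cx.X n) :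
    app (f ≫ g) n x = app g n (app f n x) := rfl

lemma app_d (f : L ⟶ M) (i j : ℤ) (x : L.cx.X i) :
    app f j ((L.cx.d i j).hom x) = (M.cx.d i j).hom (app f i x) := DGVect.f_d _ i j x

lemma hom_ext {f g : L ⟶ M} (h : ∀ n x, app f n x = app g n x) : f = g := by
  apply Hom.ext
  ext n x : 3
  exact h n x

lemma congr_app {f g : L ⟶ M} (h : f = g) (n : ℤ) (x : L.cx.X n) : app f n x = app g n x := by
  rw [h]

/-- Construct a morphism of DG-Lie algebras from its components. -/
def mkHom (f : ∀ n, L.cx.X n →ₗ[K] M.cx.X n)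
    (hd : ∀ i j x, f j ((L.cx.d i j).hom x) = (M.cx.d i j).hom (f i x))
    (hb : ∀ {p q r : ℤ} (h : p + q = r) (x : L.cx.X p) (y : L.cx.X q),
      f r (L.bracket h x y) = M.bracket h (f p x) (f q y)) : L ⟶ M :=
  Hom.mk
    { f := fun n => ModuleCat.ofHom (f n)
      comm' := fun i j _ => ModuleCat.hom_ext (LinearMap.ext fun x => (hd i j x).symm) }
    hb

lemma isWeakEquiv_comp {f : L ⟶ M} {g : M ⟶ N} (hf : IsWeakEquiv f) (hg : IsWeakEquiv g) :
    IsWeakEquiv (f ≫ g) := by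
  have : QuasiIso (Hom.hom f) := hf
  have : QuasiIso (Hom.hom g) := hg
  exact (inferInstance : QuasiIso (Hom.hom f ≫ Hom.hom g))

lemma isWeakEquiv_of_comp_left {f : L ⟶ M} {g : M ⟶ N} (hf : IsWeakEquiv f)
    (hfg : IsWeakEquiv (f ≫ g)) : IsWeakEquiv g := by
  have : QuasiIso (Hom.hom f) := hf
  have : QuasiIso (Hom.hom f ≫ Hom.hom g) := hfg
  exact quasiIso_of_comp_left (Hom.hom f) (Hom.hom g)

lemma isWeakEquiv_id (L : DGLA.{u, w} K) : IsWeakEquiv (𝟙 L) :=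
  (inferInstance : QuasiIso (𝟙 L.cx))

lemma isWeakEquiv_of_iso (e : L ≅ M) : IsWeakEquiv e.hom := by
  have : IsIso (Hom.hom e.hom) := ⟨Hom.hom e.inv, congrArg Hom.hom e.hom_inv_id,
    congrArg Hom.hom e.inv_hom_id⟩
  exact (inferInstance : QuasiIso (Hom.hom e.hom))

/-! ### Path objects -/

variable (M) in
/-- Evaluation at `t = 0`. -/
def pathZero : M.path ⟶ M :=
  mkHom (fun n => evalZero K _ ∘ₗ LinearMap.fst K (ℕ →₀ M.cx.X n) (ℕ →₀ M.cx.X (n - 1)))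
    (fun _ _ _ => evalZero_map _ _) (fun _ _ _ => evalZero_map₂ _ _ _)

variable (M) in
/-- Evaluation at `t = 1`. -/
def pathOne : M.path ⟶ M :=
  mkHom (fun n => evalOne K _ ∘ₗ LinearMap.fst K (ℕ →₀ M.cx.X n) (ℕ →₀ M.cx.X (n - 1)))
    (fun _ _ _ => evalOne_map _ _) (fun _ _ _ => evalOne_map₂ _ _ _)

variable (M) in
/-- The inclusion of constant polynomials. -/
def pathConst : M ⟶ M.path :=
  mkHom (fun n => LinearMap.inl K (ℕ →₀ M.cx.X n) (ℕ →₀ M.cx.X (n - 1)) ∘ₗ const K _)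
    (fun i j x => Prod.ext (map_const _ _).symm (by
      refine Eq.trans ?_ (pathCx_d_snd M.cx i j _).symm
      change (0 : ℕ →₀ M.cx.X (j - 1)) =
        i.negOnePow • map (M.cx.castX i (j - 1)) (deriv K _ (const K _ x)) +
          map (M.cx.d (i - 1) (j - 1)).hom 0
      simp))
    (fun {p q r} h x y => Prod.ext (map₂_const _ _ _).symm (by
      refine Eq.trans ?_ (pathBracket_snd M h _ _).symm
      change (0 : ℕ →₀ M.cx.X (r - 1)) = map₂ (M.bracket _) (const K _ x) 0 +
        q.negOnePow • map₂ (M.bracket _) 0 (const K _ y)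
      simp))

/-- The functoriality of path objects. -/
def pathMap (f : L ⟶ M) : L.path ⟶ M.path :=
  mkHom (fun n => LinearMap.prodMap (map (app f n)) (map (app f (n - 1))))
    (fun i j (x : (pathCx L.cx).X i) => Prod.ext (by
        refine Eq.trans (map_map _ _ _) (Eq.trans ?_ (map_map _ _ _).symm)
        congr 2
        exact LinearMap.ext fun x => app_d f i j x) (by
        refine Eq.trans ?_ (pathCx_d_snd M.cx i j _).symm
        refine (congrArg (map (app f (j - 1))) (pathCx_d_snd L.cx i j x)).trans ?_
        change _ =
          i.negOnePow • map (M.cx.castX i (j - 1)) (deriv K _ (map (app f i) (Prod.fst x))) +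
            map (M.cx.d (i - 1) (j - 1)).hom (map (app f (i - 1)) (Prod.snd x))
        rw [map_add, LinearMap.map_smul_of_tower, map_map, map_map, map_map,
          deriv_map, map_map]
        congr 3
        · congr 1
          exact LinearMap.ext fun x => (DGVect.castX_f (Hom.hom f) i (j - 1) x).symm
        · exact LinearMap.ext fun x => app_d f (i - 1) (j - 1) x))
    (fun {p q r} h x y => Prod.ext (map_map₂ _ _ _ _ _ (fun _ _ => Hom.map_bracket f h _ _) _ _) (by
        refine Eq.trans ?_ (pathBracket_snd M h _ _).symm
        refine (congrArg (map (app f (r - 1))) (pathBracket_snd L h x y)).trans ?_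
        change _ =
          map₂ (M.bracket _) (map (app f p) (Prod.fst x)) (map (app f (q - 1)) (Prod.snd y)) +
            q.negOnePow •
              map₂ (M.bracket _) (map (app f (p - 1)) (Prod.snd x)) (map (app f q) (Prod.fst y))
        rw [map_add, LinearMap.map_smul_of_tower,
          map_map₂ _ _ _ _ _ (Hom.map_bracket f _), map_map₂ _ _ _ _ _ (Hom.map_bracket f _)]))

lemma pathConst_zero : pathConst M ≫ pathZero M = 𝟙 M :=
  hom_ext fun n x => evalZero_const (K := K) (A := M.cx.X n) x

lemma pathConst_one : pathConst M ≫ pathOne M = 𝟙 M :=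
  hom_ext fun n x => evalOne_const (K := K) (A := M.cx.X n) x

lemma pathMap_zero (f : L ⟶ M) : pathMap f ≫ pathZero M = pathZero L ≫ f :=
  hom_ext fun _ _ => evalZero_map _ _

lemma pathMap_one (f : L ⟶ M) : pathMap f ≫ pathOne M = pathOne L ≫ f :=
  hom_ext fun _ _ => evalOne_map _ _

lemma pathConst_map (f : L ⟶ M) : pathConst L ≫ pathMap f = f ≫ pathConst M :=
  hom_ext fun n _ => Prod.ext (map_const _ _) (map_zero (map (app f (n - 1))))

/-- A polynomial Poincaré lemma relative to t = 0. The primitive is (-1)^i ∫ω: the cocycle condition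
gives dω = (-1)^i p', so the differential of this primitive is ∫p' = p - p(0) = p. -/
lemma exists_primitive [CharZero K] (V : DGVect.{u, w} K) {i j k : ℤ} (hij : i + 1 = j)
    (hjk : j + 1 = k) (p : ℕ →₀ V.X j) (ω : ℕ →₀ V.X (j - 1))
    (h : j.negOnePow • map (V.castX j (k - 1)) (deriv K _ p) +
      map (V.d (j - 1) (k - 1)).hom ω = 0) (h₀ : evalZero K _ p = 0) :
    ∃ q : ℕ →₀ V.X i, evalZero K _ q = 0 ∧ map (V.d i j).hom q = p ∧
      i.negOnePow • map (V.castX i (j - 1)) (deriv K _ q) = ω := by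
  refine ⟨i.negOnePow • map (V.castX (j - 1) i) (integral K _ ω), ?_, ?_, ?_⟩
  · rw [LinearMap.map_smul_of_tower, evalZero_map, evalZero_integral, map_zero, smul_zero]
  · have e : (V.d i j).hom ∘ₗ V.castX (j - 1) i =
        V.castX (k - 1) j ∘ₗ (V.d (j - 1) (k - 1)).hom :=
      LinearMap.ext fun x => (V.castX_d (by lia) (by lia) x).symm
    have e' : j.negOnePow = -i.negOnePow := by rw [← hij, Int.negOnePow_succ]
    have h' : map (V.castX (k - 1) j) (map (V.d (j - 1) (k - 1)).hom ω) =
        -(j.negOnePow • deriv K _ p) := by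
      rw [eq_neg_of_add_eq_zero_right h, map_neg, LinearMap.map_smul_of_tower, map_map,
        V.castX_castX (by lia), map_id]
    rw [LinearMap.map_smul_of_tower, map_map, e, ← map_map, ← integral_map, ← integral_map, h',
      map_neg, LinearMap.map_smul_of_tower, integral_deriv, h₀, map_zero, sub_zero, e', Units.neg_smul,
      neg_neg, smul_smul, Int.units_mul_self, one_smul]
  · rw [LinearMap.map_smul_of_tower, LinearMap.map_smul_of_tower, deriv_map, deriv_integral,
      map_map, V.castX_castX (by lia), map_id, smul_smul, Int.units_mul_self, one_smul]

/-- A cocycle of `M[t, dt]` vanishing at `0` is the differential of an element vanishing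
at `0`. -/
lemma path_exact [CharZero K] {i j k : ℤ} (hij : i + 1 = j) (hjk : j + 1 = k)
    (γ : M.path.cx.X j) (hγ : (M.path.cx.d j k).hom γ = 0) (h₀ : app (pathZero M) j γ = 0) :
    ∃ β : M.path.cx.X i, app (pathZero M) i β = 0 ∧ (M.path.cx.d i j).hom β = γ := by
  obtain ⟨q, hq₀, hq₁, hq₂⟩ := exists_primitive M.cx hij hjk (Prod.fst γ) (Prod.snd γ)
    ((pathCx_d_snd M.cx j k γ).symm.trans (congrArg Prod.snd hγ)) h₀
  refine ⟨((q, 0) : (ℕ →₀ M.cx.X i) × (ℕ →₀ M.cx.X (i - 1))), hq₀, Prod.ext hq₁ ?_⟩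
  refine (pathCx_d_snd M.cx i j _).trans ?_
  refine Eq.trans ?_ hq₂
  refine (congrArg (_ + ·) (map_zero (map (M.cx.d (i - 1) (j - 1)).hom))).trans (add_zero _)

end DGLA

namespace DGLA

variable {K : Type u} [Field K] {L M N L' M' N' : DGLA.{u, w} K}

/-! ### Products and pullbacks -/

/-- The product of two complexes. -/
def prodCx (V W : DGVect.{u, w} K) : DGVect.{u, w} K where
  X n := ModuleCat.of K (V.X n × W.X n)
  d i j := ModuleCat.ofHom ((V.d i j).hom.prodMap (W.d i j).hom)
  shape i j hij := by
    rw [V.shape i j hij, W.shape i j hij]; rfl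
  d_comp_d' i j k _ _ := by
    apply ModuleCat.hom_ext
    exact LinearMap.ext fun x => Prod.ext (V.d_d i j k x.1) (W.d_d i j k x.2)

/-- The product of two morphisms of complexes. -/
def prodCxMap {V W V' W' : DGVect.{u, w} K} (f : V ⟶ V') (g : W ⟶ W') :
    prodCx V W ⟶ prodCx V' W' where
  f n := ModuleCat.ofHom ((f.f n).hom.prodMap (g.f n).hom)
  comm' i j _ := by
    apply ModuleCat.hom_ext
    exact LinearMap.ext fun x => Prod.ext (DGVect.f_d f i j x.1).symm (DGVect.f_d g i j x.2).symm

lemma quasiIso_prodCxMap {V W V' W' : DGVect.{u, w} K} (f : V ⟶ V') (g : W ⟶ W')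
    [QuasiIso f] [QuasiIso g] : QuasiIso (prodCxMap f g) := by
  have hf := (DGVect.quasiIso_iff_elements f).1 inferInstance
  have hg := (DGVect.quasiIso_iff_elements g).1 inferInstance
  rw [DGVect.quasiIso_iff_elements]
  intro i j k hij hjk
  constructor
  · rintro ⟨b₁, b₂⟩ hb
    obtain ⟨a₁, ha₁, b₁', rfl⟩ := (hf i j k hij hjk).1 b₁ (congrArg Prod.fst hb)
    obtain ⟨a₂, ha₂, b₂', rfl⟩ := (hg i j k hij hjk).1 b₂ (congrArg Prod.snd hb)
    exact ⟨⟨a₁, a₂⟩, Prod.ext ha₁ ha₂, ⟨b₁', b₂'⟩, rfl⟩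
  · rintro ⟨a₁, a₂⟩ ha ⟨b₁, b₂⟩ hb
    obtain ⟨c₁, rfl⟩ := (hf i j k hij hjk).2 a₁ (congrArg Prod.fst ha) b₁ (congrArg Prod.fst hb)
    obtain ⟨c₂, rfl⟩ := (hg i j k hij hjk).2 a₂ (congrArg Prod.snd ha) b₂ (congrArg Prod.snd hb)
    exact ⟨⟨c₁, c₂⟩, rfl⟩

/-- The product of two DG-Lie algebras. -/
def prod (L M : DGLA.{u, w} K) : DGLA.{u, w} K where
  cx := prodCx L.cx M.cx
  bracket {p q r} h := LinearMap.mk₂ K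
    (fun (x : L.cx.X p × M.cx.X p) (y : L.cx.X q × M.cx.X q) =>
      ((L.bracket h x.1 y.1, M.bracket h x.2 y.2) : L.cx.X r × M.cx.X r))
    (fun _ _ _ => Prod.ext (LinearMap.map_add₂ _ _ _ _) (LinearMap.map_add₂ _ _ _ _))
    (fun _ _ _ => Prod.ext (LinearMap.map_smul₂ _ _ _ _) (LinearMap.map_smul₂ _ _ _ _))
    (fun _ _ _ => Prod.ext (map_add _ _ _) (map_add _ _ _))
    (fun _ _ _ => Prod.ext (map_smul _ _ _) (map_smul _ _ _))
  skew h h' x y := Prod.ext (L.skew h h' x.1 y.1) (M.skew h h' x.2 y.2)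
  jacobi a b c d e f x y z :=
    Prod.ext (L.jacobi a b c d e f x.1 y.1 z.1) (M.jacobi a b c d e f x.2 y.2 z.2)
  leibniz a b c d x y := Prod.ext (L.leibniz a b c d x.1 y.1) (M.leibniz a b c d x.2 y.2)

/-- The pullback of two morphisms of DG-Lie algebras. -/
def pullback (f : L ⟶ N) (g : M ⟶ N) : DGLA.{u, w} K :=
  (prod L M).sub
    (fun n => LinearMap.eqLocus (app f n ∘ₗ LinearMap.fst K (L.cx.X n) (M.cx.X n))
      (app g n ∘ₗ LinearMap.snd K (L.cx.X n) (M.cx.X n)))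
    (fun i j x hx => (app_d f i j x.1).trans
      ((congrArg (N.cx.d i j).hom hx).trans (app_d g i j x.2).symm))
    (fun h x hx y hy => (Hom.map_bracket f h x.1 y.1).trans
      ((congrArg₂ (fun a b => N.bracket h a b) hx hy).trans (Hom.map_bracket g h x.2 y.2).symm))

namespace pullback

variable (f : L ⟶ N) (g : M ⟶ N)

/-- The element of a pullback given by a compatible pair. -/
def mk {n : ℤ} (x : L.cx.X n) (y : M.cx.X n) (h : app f n x = app g n y) :
    (pullback f g).cx.X n :=
  (⟨(x, y), h⟩ : LinearMap.eqLocus (app f n ∘ₗ LinearMap.fst K (L.cx.X n) (M.cx.X n))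
      (app g n ∘ₗ LinearMap.snd K (L.cx.X n) (M.cx.X n)))

/-- The first projection. -/
def fst : pullback f g ⟶ L :=
  mkHom (fun n => LinearMap.fst K (L.cx.X n) (M.cx.X n) ∘ₗ Submodule.subtype _)
    (fun _ _ _ => rfl) (fun _ _ _ => rfl)

/-- The second projection. -/
def snd : pullback f g ⟶ M :=
  mkHom (fun n => LinearMap.snd K (L.cx.X n) (M.cx.X n) ∘ₗ Submodule.subtype _)
    (fun _ _ _ => rfl) (fun _ _ _ => rfl)

variable {f g}

lemma elem_ext {n : ℤ} {x y : (pullback f g).cx.X n} (h₁ : app (fst f g) n x = app (fst f g) n y)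
    (h₂ : app (snd f g) n x = app (snd f g) n y) : x = y :=
  Subtype.ext (Prod.ext h₁ h₂)

lemma exists_mk {n : ℤ} (x : L.cx.X n) (y : M.cx.X n) (h : app f n x = app g n y) :
    ∃ z : (pullback f g).cx.X n, app (fst f g) n z = x ∧ app (snd f g) n z = y :=
  ⟨mk f g x y h, rfl, rfl⟩

lemma condition : fst f g ≫ f = snd f g ≫ g := hom_ext fun _ x => x.2

lemma morphism_ext {a b : N' ⟶ pullback f g} (h₁ : a ≫ fst f g = b ≫ fst f g)
    (h₂ : a ≫ snd f g = b ≫ snd f g) : a = b :=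
  hom_ext fun n x => elem_ext (congr_app h₁ n x) (congr_app h₂ n x)

/-- The universal property of pullbacks. -/
def lift (a : N' ⟶ L) (b : N' ⟶ M) (h : a ≫ f = b ≫ g) : N' ⟶ pullback f g :=
  mkHom (fun n => LinearMap.codRestrict _ (LinearMap.prod (app a n) (app b n)) (congr_app h n))
    (fun i j x => elem_ext (app_d a i j x) (app_d b i j x))
    (fun h x y => elem_ext (Hom.map_bracket a h x y) (Hom.map_bracket b h x y))

/-- The functoriality of pullbacks. -/
def map {f' : L' ⟶ N'} {g' : M' ⟶ N'} (a : L ⟶ L') (b : M ⟶ M') (c : N ⟶ N')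
    (h₁ : f ≫ c = a ≫ f') (h₂ : g ≫ c = b ≫ g') : pullback f g ⟶ pullback f' g' :=
  lift (fst f g ≫ a) (snd f g ≫ b) (by
    rw [Category.assoc, Category.assoc, ← h₁, ← h₂, ← Category.assoc, condition, Category.assoc])

/-- The pullback is the kernel of (x, y) ↦ f x - g y on the product, and this difference map is onto
as soon as f is; hence `quasiIso_ker` applies. The difference is only a map of complexes, not of Lie
algebras, which suffices. -/
lemma isWeakEquiv_map {f' : L' ⟶ N'} {g' : M' ⟶ N'} {a : L ⟶ L'} {b : M ⟶ M'} {c : N ⟶ N'}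
    (h₁ : f ≫ c = a ≫ f') (h₂ : g ≫ c = b ≫ g') (ha : IsWeakEquiv a) (hb : IsWeakEquiv b)
    (hc : IsWeakEquiv c) (hf : ∀ n, Function.Surjective (app f n))
    (hf' : ∀ n, Function.Surjective (app f' n)) : IsWeakEquiv (map a b c h₁ h₂) := by
  have : QuasiIso (Hom.hom a) := ha
  have : QuasiIso (Hom.hom b) := hb
  have : QuasiIso (Hom.hom c) := hc
  have := quasiIso_prodCxMap (Hom.hom a) (Hom.hom b)
  let diff {L M N : DGLA.{u, w} K} (f : L ⟶ N) (g : M ⟶ N) : prodCx L.cx M.cx ⟶ N.cx :=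
    { f := fun n => ModuleCat.ofHom (app f n ∘ₗ LinearMap.fst K (L.cx.X n) (M.cx.X n) -
        app g n ∘ₗ LinearMap.snd K (L.cx.X n) (M.cx.X n))
      comm' := fun i j _ => ModuleCat.hom_ext <| LinearMap.ext fun x =>
        (map_sub (N.cx.d i j).hom _ _).trans
          (congrArg₂ (· - ·) (app_d f i j x.1).symm (app_d g i j x.2).symm) }
  have surj : ∀ {L M N : DGLA.{u, w} K} (f : L ⟶ N) (g : M ⟶ N),
      (∀ n, Function.Surjective (app f n)) →
      ∀ n, Function.Surjective ((diff f g).f n).hom := by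
    intro L M N f g hf n y
    obtain ⟨x, rfl⟩ := hf n y
    refine ⟨((x, 0) : L.cx.X n × M.cx.X n), ?_⟩
    change app f n x - app g n 0 = _
    rw [map_zero, sub_zero]
  exact DGVect.quasiIso_ker (p := diff f g) (p' := diff f' g')
    (e := prodCxMap (Hom.hom a) (Hom.hom b)) (b := Hom.hom c)
    (by
      ext n x : 3
      exact ((map_sub (app c n) _ _).trans
        (congrArg₂ (· - ·) (congr_app h₁ n x.1) (congr_app h₂ n x.2))).symm)
    (surj f g hf) (surj f' g' hf') _ _ (fun n x => (sub_eq_zero).symm)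
    (fun n x => (sub_eq_zero).symm) (Hom.hom (map a b c h₁ h₂)) (fun n x => rfl)

end pullback

/-! ### Functorial factorization -/

section Factorization

variable (f : L ⟶ M)

/-- The mapping path object of `f`. -/
def mapPath : DGLA.{u, w} K := pullback f (pathZero M)

/-- The inclusion of the source in the mapping path object. -/
def mapPathι : L ⟶ mapPath f := pullback.lift (𝟙 L) (f ≫ pathConst M) (by
  rw [Category.assoc, pathConst_zero, Category.id_comp, Category.comp_id])

/-- The projection of the mapping path object to the target. -/
def mapPathπ : mapPath f ⟶ M := pullback.snd f (pathZero M) ≫ pathOne M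

lemma mapPathι_π : mapPathι f ≫ mapPathπ f = f := by
  change (f ≫ pathConst M) ≫ pathOne M = f
  rw [Category.assoc, pathConst_one, Category.comp_id]

lemma mapPathπ_surjective (n : ℤ) : Function.Surjective (app (mapPathπ f) n) := by
  intro y
  -- The path t y runs from 0, the image of 0 under f, to y.
  obtain ⟨z, -, hz⟩ := pullback.exists_mk (f := f) (g := pathZero M) (n := n) 0
    ((Finsupp.single 1 y, 0) : (ℕ →₀ M.cx.X n) × (ℕ →₀ M.cx.X (n - 1))) (by
      rw [map_zero]
      exact ((VectorPolynomial.evalZero_single (K := K) 1 y).trans (if_neg one_ne_zero)).symm)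
  refine ⟨z, ?_⟩
  change app (pathOne M) n (app (pullback.snd f (pathZero M)) n z) = y
  rw [hz]
  exact VectorPolynomial.evalOne_single (K := K) 1 y

/-- A cocycle (x, γ) differs from the image of x by (0, γ - γ(0)), and γ - γ(0) is a cocycle
vanishing at 0, so `path_exact` supplies a primitive inside the pullback. Injectivity on cohomology
holds because the first projection is a left inverse. -/
lemma isWeakEquiv_mapPathι [CharZero K] : IsWeakEquiv (mapPathι f) := by
  refine (DGVect.quasiIso_iff_elements _).2 fun i j k hij hjk => ⟨fun b hb => ?_, ?_⟩
  · set x := app (pullback.fst f (pathZero M)) j b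
    set γ := app (pullback.snd f (pathZero M)) j b
    have hγ : app f j x = app (pathZero M) j γ := congr_app pullback.condition j b
    have dx : (L.cx.d j k).hom x = 0 :=
      (app_d (pullback.fst f (pathZero M)) j k b).symm.trans
        ((congrArg _ hb).trans (map_zero (app (pullback.fst f (pathZero M)) k)))
    have dγ : (M.path.cx.d j k).hom γ = 0 :=
      (app_d (pullback.snd f (pathZero M)) j k b).symm.trans
        ((congrArg _ hb).trans (map_zero (app (pullback.snd f (pathZero M)) k)))
    obtain ⟨β, hβ, dβ⟩ := path_exact hij hjk (γ - app (pathConst M) j (app f j x))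
      (by rw [map_sub, dγ, ← app_d (pathConst M), ← app_d f, dx, map_zero, map_zero, sub_zero])
      (by
        rw [map_sub, ← hγ]
        exact sub_eq_zero.2 (congr_app pathConst_zero j (app f j x)).symm)
    obtain ⟨b', hb₁, hb₂⟩ := pullback.exists_mk (f := f) (g := pathZero M) 0 β
      (by rw [map_zero, hβ])
    refine ⟨x, dx, b', pullback.elem_ext ?_ ?_⟩
    · refine Eq.trans ?_ (map_add (app (pullback.fst f (pathZero M)) j) _ _).symm
      refine Eq.trans ?_ (congrArg (x + ·) (app_d (pullback.fst f (pathZero M)) i j b').symm)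
      rw [hb₁, map_zero, add_zero]
    · refine Eq.trans ?_ (map_add (app (pullback.snd f (pathZero M)) j) _ _).symm
      refine Eq.trans ?_ (congrArg (app (pathConst M) j (app f j x) + ·)
        (app_d (pullback.snd f (pathZero M)) i j b').symm)
      rw [hb₂, dβ]
      exact (add_sub_cancel _ γ).symm
  · intro a ha b' hb
    refine ⟨app (pullback.fst f (pathZero M)) i b', ?_⟩
    exact (congrArg (app (pullback.fst f (pathZero M)) j) hb).trans (app_d _ i j b')

variable {f}

/-- The functoriality of mapping path objects. -/
def mapPathMap {f' : L' ⟶ M'} (a : L ⟶ L') (b : M ⟶ M') (h : f ≫ b = a ≫ f') :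
    mapPath f ⟶ mapPath f' :=
  pullback.map a (pathMap b) b h (pathMap_zero b).symm

lemma mapPathι_map {f' : L' ⟶ M'} (a : L ⟶ L') (b : M ⟶ M') (h : f ≫ b = a ≫ f') :
    mapPathι f ≫ mapPathMap a b h = a ≫ mapPathι f' := by
  refine pullback.morphism_ext rfl ?_
  change (f ≫ pathConst M) ≫ pathMap b = a ≫ f' ≫ pathConst M'
  rw [Category.assoc, pathConst_map, ← Category.assoc, h, Category.assoc]

lemma mapPathMap_π {f' : L' ⟶ M'} (a : L ⟶ L') (b : M ⟶ M') (h : f ≫ b = a ≫ f') :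
    mapPathMap a b h ≫ mapPathπ f' = mapPathπ f ≫ b := by
  change (pullback.snd f (pathZero M) ≫ pathMap b) ≫ pathOne M' =
    (pullback.snd f (pathZero M) ≫ pathOne M) ≫ b
  rw [Category.assoc, pathMap_one, Category.assoc]

end Factorization

end DGLA

namespace DGLA

variable {K : Type u} [Field K]

/-! ### Functorial fibrant replacement of squares -/

section Resolution

variable (S T : Square (DGLA.{u, w} K)) (φ : S ⟶ T)

/-- The pullback of the mapping path objects of the two morphisms to the last corner. -/
def resolutionBase : DGLA.{u, w} K := pullback (mapPathπ S.f₂₄) (mapPathπ S.f₃₄)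

/-- The morphism from the first corner to the base of the resolution. -/
def toResolutionBase : S.X₁ ⟶ resolutionBase S :=
  pullback.lift (S.f₁₂ ≫ mapPathι S.f₂₄) (S.f₁₃ ≫ mapPathι S.f₃₄) (by
    rw [Category.assoc, mapPathι_π, Category.assoc, mapPathι_π, S.fac])

/-- The functorial fibrant replacement of a square. -/
def resolution : Square (DGLA.{u, w} K) where
  X₁ := mapPath (toResolutionBase S)
  X₂ := mapPath S.f₂₄
  X₃ := mapPath S.f₃₄
  X₄ := S.X₄
  f₁₂ := mapPathπ (toResolutionBase S) ≫ pullback.fst _ _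
  f₁₃ := mapPathπ (toResolutionBase S) ≫ pullback.snd _ _
  f₂₄ := mapPathπ S.f₂₄
  f₃₄ := mapPathπ S.f₃₄
  fac := congrArg (mapPathπ (toResolutionBase S) ≫ ·)
    (pullback.condition (f := mapPathπ S.f₂₄) (g := mapPathπ S.f₃₄))

/-- Each of the three conditions is the surjectivity of one `mapPathπ`; the third uses that the
first corner was factored over the pullback itself. -/
lemma isFibrantSquare_resolution : IsFibrantSquare (resolution S) := by
  refine ⟨mapPathπ_surjective _, mapPathπ_surjective _, fun n x y h => ?_⟩
  obtain ⟨b, rfl, rfl⟩ := pullback.exists_mk x y h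
  obtain ⟨z, rfl⟩ := mapPathπ_surjective (toResolutionBase S) n b
  exact ⟨z, rfl, rfl⟩

/-- The morphism from a square to its fibrant replacement. -/
def toResolution : S ⟶ resolution S where
  τ₁ := mapPathι (toResolutionBase S)
  τ₂ := mapPathι S.f₂₄
  τ₃ := mapPathι S.f₃₄
  τ₄ := 𝟙 S.X₄
  comm₁₂ := (congrArg (· ≫ pullback.fst (mapPathπ S.f₂₄) (mapPathπ S.f₃₄))
    (mapPathι_π (toResolutionBase S))).symm
  comm₁₃ := (congrArg (· ≫ pullback.snd (mapPathπ S.f₂₄) (mapPathπ S.f₃₄))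
    (mapPathι_π (toResolutionBase S))).symm
  comm₂₄ := (mapPathι_π S.f₂₄).symm
  comm₃₄ := (mapPathι_π S.f₃₄).symm

lemma isSquareWeakEquiv_toResolution [CharZero K] : IsSquareWeakEquiv (toResolution S) :=
  ⟨isWeakEquiv_mapPathι _, isWeakEquiv_mapPathι _, isWeakEquiv_mapPathι _, isWeakEquiv_id _⟩

variable {S T}

/-- The functoriality of the base of the resolution. -/
def resolutionBaseMap : resolutionBase S ⟶ resolutionBase T :=
  pullback.map (mapPathMap φ.τ₂ φ.τ₄ φ.comm₂₄) (mapPathMap φ.τ₃ φ.τ₄ φ.comm₃₄) φ.τ₄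
    (mapPathMap_π _ _ _).symm (mapPathMap_π _ _ _).symm

lemma toResolutionBase_map :
    toResolutionBase S ≫ resolutionBaseMap φ = φ.τ₁ ≫ toResolutionBase T := by
  refine pullback.morphism_ext ?_ ?_
  · change (S.f₁₂ ≫ mapPathι S.f₂₄) ≫ mapPathMap φ.τ₂ φ.τ₄ φ.comm₂₄ =
      φ.τ₁ ≫ T.f₁₂ ≫ mapPathι T.f₂₄
    rw [Category.assoc, mapPathι_map, ← Category.assoc, φ.comm₁₂, Category.assoc]
  · change (S.f₁₃ ≫ mapPathι S.f₃₄) ≫ mapPathMap φ.τ₃ φ.τ₄ φ.comm₃₄ =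
      φ.τ₁ ≫ T.f₁₃ ≫ mapPathι T.f₃₄
    rw [Category.assoc, mapPathι_map, ← Category.assoc, φ.comm₁₃, Category.assoc]

/-- The functoriality of the fibrant replacement. -/
def resolutionMap : resolution S ⟶ resolution T where
  τ₁ := mapPathMap φ.τ₁ (resolutionBaseMap φ) (toResolutionBase_map φ)
  τ₂ := mapPathMap φ.τ₂ φ.τ₄ φ.comm₂₄
  τ₃ := mapPathMap φ.τ₃ φ.τ₄ φ.comm₃₄
  τ₄ := φ.τ₄
  comm₁₂ := (congrArg (· ≫ pullback.fst (mapPathπ T.f₂₄) (mapPathπ T.f₃₄))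
    (mapPathMap_π _ _ (toResolutionBase_map φ))).symm
  comm₁₃ := (congrArg (· ≫ pullback.snd (mapPathπ T.f₂₄) (mapPathπ T.f₃₄))
    (mapPathMap_π _ _ (toResolutionBase_map φ))).symm
  comm₂₄ := (mapPathMap_π _ _ φ.comm₂₄).symm
  comm₃₄ := (mapPathMap_π _ _ φ.comm₃₄).symm

/-- A mapping path object is weakly equivalent to its source through `mapPathι`, naturally, so two
out of three applies at each of the first three corners. -/
lemma isSquareWeakEquiv_resolutionMap [CharZero K] (h : IsSquareWeakEquiv φ) :
    IsSquareWeakEquiv (resolutionMap φ) := by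
  have key : ∀ {L M L' M' : DGLA.{u, w} K} {f : L ⟶ M} {f' : L' ⟶ M'} (a : L ⟶ L') (b : M ⟶ M')
      (h : f ≫ b = a ≫ f') (_ : IsWeakEquiv a), IsWeakEquiv (mapPathMap a b h) := by
    intro L M L' M' f f' a b h ha
    refine isWeakEquiv_of_comp_left (isWeakEquiv_mapPathι f) ?_
    rw [mapPathι_map]
    exact isWeakEquiv_comp ha (isWeakEquiv_mapPathι f')
  exact ⟨key _ _ (toResolutionBase_map φ) h.1, key _ _ φ.comm₂₄ h.2.1, key _ _ φ.comm₃₄ h.2.2.1,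
    h.2.2.2⟩

end Resolution

/-! ### Homotopy invariance of double homotopy fibers -/

section DoubleFiber

variable {S T : Square (DGLA.{u, w} K)} (φ : S ⟶ T)

/-- The functoriality of double fibers. -/
def doubleFiberMap : doubleFiber S ⟶ doubleFiber T :=
  mkHom
    (fun n => LinearMap.restrict (app φ.τ₁ n)
      (p := LinearMap.ker (app S.f₁₂ n) ⊓ LinearMap.ker (app S.f₁₃ n))
      (q := LinearMap.ker (app T.f₁₂ n) ⊓ LinearMap.ker (app T.f₁₃ n)) (by
        rintro x ⟨h₁, h₂⟩
        replace h₁ : app S.f₁₂ n x = 0 := h₁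
        replace h₂ : app S.f₁₃ n x = 0 := h₂
        refine ⟨?_, ?_⟩
        · refine (congr_app φ.comm₁₂ n x).symm.trans ?_
          rw [comp_app, h₁, map_zero]
        · refine (congr_app φ.comm₁₃ n x).symm.trans ?_
          rw [comp_app, h₂, map_zero]))
    (fun i j x => Subtype.ext (app_d φ.τ₁ i j x.1))
    (fun h x y => Subtype.ext (Hom.map_bracket φ.τ₁ h x.1 y.1))

/-- Fibrancy makes the double fiber the kernel of a surjection from the first corner onto the
pullback of the others. The pullback is homotopy invariant by `pullback.isWeakEquiv_map`, and then
the kernel is by `quasiIso_ker`. -/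
lemma isWeakEquiv_doubleFiberMap (hφ : IsSquareWeakEquiv φ) (hS : IsFibrantSquare S)
    (hT : IsFibrantSquare T) : IsWeakEquiv (doubleFiberMap φ) := by
  let p (S : Square (DGLA.{u, w} K)) : S.X₁ ⟶ pullback S.f₂₄ S.f₃₄ :=
    pullback.lift S.f₁₂ S.f₁₃ S.fac
  have surj : ∀ S : Square (DGLA.{u, w} K), IsFibrantSquare S →
      ∀ n, Function.Surjective (app (p S) n) := by
    intro S hS n b
    obtain ⟨z, h₁, h₂⟩ := hS.2.2 n (app (pullback.fst _ _) n b) (app (pullback.snd _ _) n b)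
      (congr_app pullback.condition n b)
    exact ⟨z, pullback.elem_ext h₁ h₂⟩
  have mem : ∀ (S : Square (DGLA.{u, w} K)) (n : ℤ) (x : S.X₁.cx.X n),
      x ∈ LinearMap.ker (app S.f₁₂ n) ⊓ LinearMap.ker (app S.f₁₃ n) ↔ app (p S) n x = 0 := by
    intro S n x
    refine ⟨fun h => pullback.elem_ext (h.1.trans (map_zero (app (pullback.fst _ _) n)).symm)
      (h.2.trans (map_zero (app (pullback.snd _ _) n)).symm), fun h => ⟨?_, ?_⟩⟩
    · exact (congrArg (app (pullback.fst S.f₂₄ S.f₃₄) n) h).trans (map_zero _)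
    · exact (congrArg (app (pullback.snd S.f₂₄ S.f₃₄) n) h).trans (map_zero _)
  let b : pullback S.f₂₄ S.f₃₄ ⟶ pullback T.f₂₄ T.f₃₄ :=
    pullback.map φ.τ₂ φ.τ₃ φ.τ₄ φ.comm₂₄ φ.comm₃₄
  have : QuasiIso (Hom.hom b) :=
    pullback.isWeakEquiv_map _ _ hφ.2.1 hφ.2.2.1 hφ.2.2.2 hS.1 hT.1
  have : QuasiIso (Hom.hom φ.τ₁) := hφ.1
  have comm : φ.τ₁ ≫ p T = p S ≫ b := 
    pullback.morphism_ext φ.comm₁₂.symm φ.comm₁₃.symm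
  exact DGVect.quasiIso_ker (p := Hom.hom (p S)) (p' := Hom.hom (p T)) (e := Hom.hom φ.τ₁)
    (b := Hom.hom b) (congrArg Hom.hom comm) (surj S hS) (surj T hT) _ _ (mem S) (mem T)
    (Hom.hom (doubleFiberMap φ)) (fun _ _ => rfl)

lemma HomotopyEquivalent.of_isWeakEquiv {L M : DGLA.{u, w} K} (f : L ⟶ M) (hf : IsWeakEquiv f) :
    L.HomotopyEquivalent M := .rel _ _ ⟨f, hf⟩

lemma exists_isDoubleHomotopyFiber [CharZero K] (S : Square (DGLA.{u, w} K)) :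
    ∃ L, IsDoubleHomotopyFiber S L :=
  ⟨doubleFiber (resolution S), resolution S, toResolution S, isSquareWeakEquiv_toResolution S,
    isFibrantSquare_resolution S, ⟨Iso.refl _⟩⟩

lemma doubleFiber_resolution_homotopyEquivalent [CharZero K] (hφ : IsSquareWeakEquiv φ) :
    (doubleFiber (resolution S)).HomotopyEquivalent (doubleFiber (resolution T)) :=
  .of_isWeakEquiv _ (isWeakEquiv_doubleFiberMap _ (isSquareWeakEquiv_resolutionMap φ hφ)
    (isFibrantSquare_resolution S) (isFibrantSquare_resolution T))

/-- An arbitrary fibrant resolution S → T need not map to the functorial one, but both compare with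
`resolution T`: through T → `resolution T` and through `resolution S` → `resolution T`. -/
lemma IsDoubleHomotopyFiber.homotopyEquivalent_resolution [CharZero K] {L : DGLA.{u, w} K}
    (h : IsDoubleHomotopyFiber S L) : L.HomotopyEquivalent (doubleFiber (resolution S)) := by
  obtain ⟨T, φ, hφ, hT, ⟨e⟩⟩ := h
  refine (HomotopyEquivalent.of_isWeakEquiv e.hom (isWeakEquiv_of_iso e)).trans _ _ _ ?_
  refine .trans _ _ _ (HomotopyEquivalent.of_isWeakEquiv _ (isWeakEquiv_doubleFiberMap
    (toResolution T) (isSquareWeakEquiv_toResolution T) hT (isFibrantSquare_resolution T))) ?_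
  exact .symm _ _ (doubleFiber_resolution_homotopyEquivalent φ hφ)

/-- Two squares are weakly equivalent if they are joined by a zigzag of weak equivalences. -/
def SquareEquivalent (S T : Square (DGLA.{u, w} K)) : Prop :=
  Relation.EqvGen (fun A B : Square (DGLA.{u, w} K) => ∃ φ : A ⟶ B, IsSquareWeakEquiv φ) S T

/-- Double homotopy fibers of weakly equivalent squares are homotopy equivalent. -/
theorem SquareEquivalent.homotopyEquivalent [CharZero K] (h : SquareEquivalent S T)
    {L M : DGLA.{u, w} K} (hL : IsDoubleHomotopyFiber S L) (hM : IsDoubleHomotopyFiber T M) :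
    L.HomotopyEquivalent M := by
  refine hL.homotopyEquivalent_resolution.trans _ _ _
    (.trans _ _ _ ?_ (hM.homotopyEquivalent_resolution.symm _ _))
  clear hL hM
  induction h with
  | rel A B h =>
    obtain ⟨φ, hφ⟩ := h
    exact doubleFiber_resolution_homotopyEquivalent φ hφ
  | refl A => exact .refl _
  | symm A B _ ih => exact .symm _ _ ih
  | trans A B C _ _ ih₁ ih₂ => exact .trans _ _ _ ih₁ ih₂

end DoubleFiber

end DGLA

namespace DGVect

variable {K : Type u} [Field K] {V W : DGVect.{u, w} K}

/-! ### Endomorphisms of a deformation retract -/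

/-- The cochain `i ∘ ξ ∘ r`. -/
def conj (i : V ⟶ W) (r : W ⟶ V) {n : ℤ} (ξ : Cochain V V n) : Cochain W W n :=
  (Cochain.ofHom r).comp (ξ.comp (Cochain.ofHom i) (add_zero n)) (zero_add n)

lemma conj_v (i : V ⟶ W) (r : W ⟶ V) {n : ℤ} (ξ : Cochain V V n) (p q : ℤ) (h : p + n = q) :
    (conj i r ξ).v p q h = r.f p ≫ ξ.v p q h ≫ i.f q := by
  simp [conj]

lemma conj_v_apply (i : V ⟶ W) (r : W ⟶ V) {n : ℤ} (ξ : Cochain V V n) (p q : ℤ) (h : p + n = q)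
    (x : W.X p) :
    ((conj i r ξ).v p q h).hom x = (i.f q).hom ((ξ.v p q h).hom ((r.f p).hom x)) := by
  rw [conj_v]; rfl

lemma conj_conj {i : V ⟶ W} {r : W ⟶ V} (hir : i ≫ r = 𝟙 V) {n : ℤ} (ξ : Cochain V V n) :
    conj r i (conj i r ξ) = ξ := by
  have : ∀ n, i.f n ≫ r.f n = 𝟙 _ := fun n => by
    rw [← HomologicalComplex.comp_f, hir, HomologicalComplex.id_f]
  ext p q h : 1
  rw [conj_v, conj_v]
  simp [reassoc_of% this, this]

lemma δ_conj (i : V ⟶ W) (r : W ⟶ V) (m n : ℤ) (ξ : Cochain V V m) :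
    δ m n (conj i r ξ) = conj i r (δ m n ξ) := by
  simp only [conj, δ_ofHom_comp, δ_comp_ofHom]

/-- Multiplicativity needs r ∘ i = 1 strictly, since r ∘ i appears between the two factors; this is
why retracts are used instead of mere homotopy equivalences. -/
lemma conj_comp {i : V ⟶ W} {r : W ⟶ V} (hir : i ≫ r = 𝟙 V) {p q n : ℤ} (h : p + q = n)
    (ξ : Cochain V V p) (η : Cochain V V q) :
    conj i r (ξ.comp η h) = (conj i r ξ).comp (conj i r η) h := by
  have : ∀ n, i.f n ≫ r.f n = 𝟙 _ := fun n => by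
    rw [← HomologicalComplex.comp_f, hir, HomologicalComplex.id_f]
  ext a b hab : 1
  rw [Cochain.comp_v _ _ h a (a + p) b rfl (by lia), conj_v, conj_v, conj_v,
    Cochain.comp_v _ _ h a (a + p) b rfl (by lia)]
  simp only [Category.assoc]
  rw [reassoc_of% this]

lemma conj_commutator {i : V ⟶ W} {r : W ⟶ V} (hir : i ≫ r = 𝟙 V) {p q n : ℤ} (h : p + q = n)
    (ξ : Cochain V V p) (η : Cochain V V q) :
    conj i r (V.commutator h ξ η) = W.commutator h (conj i r ξ) (conj i r η) := by
  simp only [commutator, ← conj_comp hir]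
  simp only [conj, Cochain.sub_comp, Cochain.comp_sub, Cochain.units_smul_comp,
    Cochain.comp_units_smul]

/-- The linear map `ξ ↦ i ∘ ξ ∘ r`. -/
def conjHom (i : V ⟶ W) (r : W ⟶ V) (n : ℤ) : Cochain V V n →ₗ[K] Cochain W W n where
  toFun := conj i r
  map_add' x y := by simp only [conj, Cochain.add_comp, Cochain.comp_add]
  map_smul' c x := by simp only [conj, Cochain.smul_comp, Cochain.comp_smul, RingHom.id_apply]

/-- The DG-Lie algebra morphism `ξ ↦ i ∘ ξ ∘ r`, for `r` a retraction of `i`. -/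
def conjEnd {i : V ⟶ W} {r : W ⟶ V} (hir : i ≫ r = 𝟙 V) : V.End ⟶ W.End :=
  DGLA.mkHom (L := V.End) (M := W.End) (conjHom i r) (fun m n ξ => (δ_conj i r m n ξ).symm)
    (fun h ξ η => conj_commutator hir h ξ η)

/-- The restriction of `conjEnd` to DG-Lie subalgebras. -/
def conjSub {i : V ⟶ W} {r : W ⟶ V} (hir : i ≫ r = 𝟙 V)
    {S : ∀ n, Submodule K (V.End.cx.X n)} {T : ∀ n, Submodule K (W.End.cx.X n)}
    (hS : ∀ i j, ∀ x ∈ S i, (V.End.cx.d i j).hom x ∈ S j)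
    (hS' : ∀ {p q r : ℤ} (h : p + q = r), ∀ x ∈ S p, ∀ y ∈ S q, V.End.bracket h x y ∈ S r)
    (hT : ∀ i j, ∀ x ∈ T i, (W.End.cx.d i j).hom x ∈ T j)
    (hT' : ∀ {p q r : ℤ} (h : p + q = r), ∀ x ∈ T p, ∀ y ∈ T q, W.End.bracket h x y ∈ T r)
    (hST : ∀ n, ∀ ξ ∈ S n, conjHom i r n ξ ∈ T n) :
    V.End.sub S hS hS' ⟶ W.End.sub T hT hT' :=
  DGLA.mkHom (fun n => LinearMap.restrict (conjHom i r n) (hST n))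
    (fun m n ξ => Subtype.ext (δ_conj i r m n ξ.1).symm)
    (fun h ξ η => Subtype.ext (conj_commutator hir h ξ.1 η.1))

variable (V W) in
/-- A deformation retract: `W` deforms onto the direct summand `V`. -/
structure DeformationRetract where
  /-- the inclusion -/
  i : V ⟶ W
  /-- the retraction -/
  r : W ⟶ V
  /-- the homotopy -/
  h : Cochain W W (-1)
  i_r : i ≫ r = 𝟙 V
  δ_h : δ (-1) 0 h = Cochain.ofHom (𝟙 W) - Cochain.ofHom (r ≫ i)

namespace DeformationRetract

variable (D : DeformationRetract V W)

/-- The homotopy induced on endomorphisms by a deformation retract. -/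
def endHomotopy {m n : ℤ} (hmn : m + 1 = n) (η : Cochain W W n) : Cochain W W m :=
  η.comp D.h (by lia) +
    n.negOnePow • D.h.comp (η.comp (Cochain.ofHom (D.r ≫ D.i)) (add_zero n)) (by lia)

/-- Put e = i ∘ r, so that δh = 1 - e. For a cocycle η, the differential of h η + (-1)^n e η h is (1
- e) η + e η (1 - e) = η - e η e. -/
lemma eq_conj_add_δ {m n k : ℤ} (hmn : m + 1 = n) (hnk : n + 1 = k) (η : Cochain W W n)
    (hη : δ n k η = 0) :
    η = conj D.i D.r (conj D.r D.i η) + δ m n (D.endHomotopy hmn η) := by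
  have e : conj D.i D.r (conj D.r D.i η) = (Cochain.ofHom (D.r ≫ D.i)).comp
      (η.comp (Cochain.ofHom (D.r ≫ D.i)) (add_zero n)) (zero_add n) := by
    ext p q h : 1
    simp [conj_v]
  have hη' : δ n k (η.comp (Cochain.ofHom (D.r ≫ D.i)) (add_zero n)) = 0 := by
    rw [δ_comp_ofHom, hη, Cochain.zero_comp]
  rw [e, endHomotopy, δ_add, δ_units_smul, δ_comp η D.h (by lia) k 0 n hmn hnk (by lia),
    δ_comp D.h _ (by lia) 0 k n hmn (by lia) hnk, hη, hη', D.δ_h]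
  simp only [Cochain.zero_comp, Cochain.comp_zero, smul_zero, add_zero, zero_add, smul_smul,
    Int.units_mul_self, one_smul, Cochain.comp_sub, Cochain.sub_comp]
  rw [Cochain.comp_id, Cochain.id_comp]
  abel

/-- A deformation retract preserves families of subspaces. -/
structure Preserves (A : ∀ n, Submodule K (V.X n)) (B : ∀ n, Submodule K (W.X n)) : Prop where
  i_mem : ∀ n, ∀ x ∈ A n, (D.i.f n).hom x ∈ B n
  r_mem : ∀ n, ∀ x ∈ B n, (D.r.f n).hom x ∈ A n
  h_mem : D.h ∈ W.mapsInto B B (-1)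

variable {D} {A A' : ∀ n, Submodule K (V.X n)} {B B' : ∀ n, Submodule K (W.X n)}

lemma Preserves.conj_mem (hA : D.Preserves A B) (hA' : D.Preserves A' B') {n : ℤ}
    {ξ : Cochain V V n} (hξ : ξ ∈ V.mapsInto A A' n) :
    conj D.i D.r ξ ∈ W.mapsInto B B' n := by
  intro p q h x hx
  rw [conj_v_apply]
  exact hA'.i_mem _ _ (hξ _ _ _ _ (hA.r_mem _ _ hx))

lemma Preserves.conj_mem' (hA : D.Preserves A B) (hA' : D.Preserves A' B') {n : ℤ}
    {η : Cochain W W n} (hη : η ∈ W.mapsInto B B' n) :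
    conj D.r D.i η ∈ V.mapsInto A A' n := by
  intro p q h x hx
  rw [conj_v_apply]
  exact hA'.r_mem _ _ (hη _ _ _ _ (hA.i_mem _ _ hx))

lemma Preserves.endHomotopy_mem (hA : D.Preserves A B) (hA' : D.Preserves A' B') {m n : ℤ}
    (hmn : m + 1 = n) {η : Cochain W W n} (hη : η ∈ W.mapsInto B B' n) :
    D.endHomotopy hmn η ∈ W.mapsInto B B' m := by
  have h₁ : η.comp D.h (by lia : n + -1 = m) ∈ W.mapsInto B B' m :=
    W.comp_mem_mapsInto _ hA'.h_mem hη
  have h₂ : Cochain.ofHom (D.r ≫ D.i) ∈ W.mapsInto B' B' 0 := by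
    intro p q h x hx
    obtain rfl : p = q := by lia
    rw [Cochain.ofHom_v]
    exact hA'.i_mem _ _ (hA'.r_mem _ _ hx)
  have h₃ : D.h.comp (η.comp (Cochain.ofHom (D.r ≫ D.i)) (add_zero n)) (by lia : -1 + n = m) ∈
      W.mapsInto B B' m :=
    W.comp_mem_mapsInto _ (W.comp_mem_mapsInto _ h₂ hη) hA.h_mem
  refine add_mem h₁ ?_
  obtain e | e := Int.units_eq_one_or n.negOnePow
  · rw [e, one_smul]; exact h₃
  · rw [e, Units.neg_smul, one_smul]; exact neg_mem h₃

variable (D)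

/-- Surjectivity on cohomology is `eq_conj_add_δ`; injectivity holds because η ↦ r ∘ η ∘ i is a left
inverse commuting with the differentials. -/
lemma isWeakEquiv_conjEnd : DGLA.IsWeakEquiv (conjEnd D.i_r) := by
  refine (quasiIso_iff_elements _).2 fun m n k hmn hnk => ⟨fun (η : Cochain W W n) hη => ?_,
    fun (ξ : Cochain V V n) hξ (η : Cochain W W m) hξη => ?_⟩
  · refine ⟨conj D.r D.i η, ?_, D.endHomotopy hmn η, D.eq_conj_add_δ hmn hnk η hη⟩
    exact (δ_conj D.r D.i n k η).trans ((congrArg (conj D.r D.i) hη).trans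
      (map_zero (conjHom D.r D.i k)))
  · refine ⟨conj D.r D.i η, ?_⟩
    exact (conj_conj D.i_r ξ).symm.trans ((congrArg (conj D.r D.i) hξη).trans
      (δ_conj D.r D.i m n η).symm)

/-- The argument of `isWeakEquiv_conjEnd` restricts to subalgebras preserved by both conjugations
and by the homotopy. It serves the other three corners of the Jacobian square. -/
lemma isWeakEquiv_conjSub
    {S : ∀ n, Submodule K (V.End.cx.X n)} {T : ∀ n, Submodule K (W.End.cx.X n)}
    (hS : ∀ i j, ∀ x ∈ S i, (V.End.cx.d i j).hom x ∈ S j)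
    (hS' : ∀ {p q r : ℤ} (h : p + q = r), ∀ x ∈ S p, ∀ y ∈ S q, V.End.bracket h x y ∈ S r)
    (hT : ∀ i j, ∀ x ∈ T i, (W.End.cx.d i j).hom x ∈ T j)
    (hT' : ∀ {p q r : ℤ} (h : p + q = r), ∀ x ∈ T p, ∀ y ∈ T q, W.End.bracket h x y ∈ T r)
    (hST : ∀ n, ∀ ξ ∈ S n, conjHom D.i D.r n ξ ∈ T n)
    (hTS : ∀ n, ∀ η ∈ T n, conjHom D.r D.i n η ∈ S n)
    (hH : ∀ m n (hmn : m + 1 = n) (η : Cochain W W n), η ∈ T n → D.endHomotopy hmn η ∈ T m) :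
    DGLA.IsWeakEquiv (conjSub D.i_r hS hS' hT hT' hST) := by
  refine (quasiIso_iff_elements _).2 fun m n k hmn hnk => ⟨fun (η : T n) hη => ?_,
    fun (ξ : S n) hξ (η : T m) hξη => ?_⟩
  · replace hη : δ n k η.1 = 0 := congrArg Subtype.val hη
    refine ⟨(⟨_, hTS n η.1 η.2⟩ : S n), Subtype.ext ?_,
      (⟨_, hH m n hmn η.1 η.2⟩ : T m), Subtype.ext (D.eq_conj_add_δ hmn hnk η.1 hη)⟩
    exact (δ_conj D.r D.i n k η.1).trans ((congrArg (conj D.r D.i) hη).trans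
      (map_zero (conjHom D.r D.i k)))
  · refine ⟨(⟨_, hTS m η.1 η.2⟩ : S m), Subtype.ext ?_⟩
    exact (conj_conj D.i_r ξ.1).symm.trans ((congrArg (conj D.r D.i)
      (congrArg Subtype.val hξη)).trans (δ_conj D.r D.i m n η.1).symm)

end DeformationRetract

end DGVect

/-! ### Extending deformation retracts to V ⊕ K. -/

namespace DGVect

variable {K : Type u} [Field K] {V W : DGVect.{u, max w u} K}

/-- The functoriality of `V ⊕ K`. -/
def addUnitMap (f : V ⟶ W) : addUnit.{u, w} V ⟶ addUnit.{u, w} W where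
  f n := ModuleCat.ofHom ((f.f n).hom.prodMap (LinearMap.id : unitPart K n →ₗ[K] unitPart K n))
  comm' i j _ := ModuleCat.hom_ext <| LinearMap.ext fun x =>
    Prod.ext (f_d f i j x.1).symm rfl

lemma conj_extend (i : V ⟶ W) (r : W ⟶ V) {n : ℤ} (ξ : Cochain V V n) :
    conj (addUnitMap.{u, w} i) (addUnitMap.{u, w} r) (extend.{u, w} V ξ) =
      extend.{u, w} W (conj i r ξ) := by
  ext p q h : 1
  rw [conj_v, extend_v, extend_v, conj_v]
  rfl

namespace DeformationRetract

variable (D : DeformationRetract V W)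

/-- The deformation retract of `W ⊕ K` onto `V ⊕ K`. -/
def addUnit : DeformationRetract (DGVect.addUnit.{u, w} V) (DGVect.addUnit.{u, w} W) where
  i := addUnitMap.{u, w} D.i
  r := addUnitMap.{u, w} D.r
  h := extend.{u, w} W D.h
  i_r := by
    ext n x : 3
    exact Prod.ext (LinearMap.congr_fun (congrArg
      (fun t : V ⟶ V => (HomologicalComplex.Hom.f t n).hom) D.i_r) x.1) rfl
  δ_h := by
    have : δ (-1) 0 (extend.{u, w} W D.h) = extend.{u, w} W (δ (-1) 0 D.h) := by
      simp only [extend, δ_ofHom_comp, δ_comp_ofHom]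
    rw [this, D.δ_h]
    ext p : 1
    rw [extend_v, Cochain.sub_v, Cochain.sub_v, Cochain.ofHom_v, Cochain.ofHom_v,
      Cochain.ofHom_v, Cochain.ofHom_v]
    -- On the summand K the homotopy is zero, matching 1 - 1 because the inclusion and the
    -- retraction are both the identity there.
    apply ModuleCat.hom_ext
    refine LinearMap.ext fun x => Prod.ext rfl ?_
    exact (sub_self _).symm

variable {D} {A : ∀ n, Submodule K (V.X n)} {B : ∀ n, Submodule K (W.X n)}

lemma preserves_top : D.Preserves (fun _ => ⊤) (fun _ => ⊤) :=
  ⟨fun _ _ _ => trivial, fun _ _ _ => trivial, fun _ _ _ _ _ => trivial⟩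

lemma Preserves.withUnit (h : D.Preserves A B) :
    (addUnit.{u, w} D).Preserves (withUnit.{u, w} V A) (withUnit.{u, w} W B) where
  i_mem n x hx := ⟨h.i_mem n _ hx.1, trivial⟩
  r_mem n x hx := ⟨h.r_mem n _ hx.1, trivial⟩
  h_mem p q hpq x hx := by
    change ((extend.{u, w} W D.h).v p q hpq).hom x ∈ _
    rw [extend_v]
    exact ⟨h.h_mem p q hpq _ hx.1, trivial⟩

lemma Preserves.withoutUnit (h : D.Preserves A B) :
    (addUnit.{u, w} D).Preserves (withoutUnit.{u, w} V A) (withoutUnit.{u, w} W B) where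
  i_mem n x hx := ⟨h.i_mem n _ hx.1, hx.2⟩
  r_mem n x hx := ⟨h.r_mem n _ hx.1, hx.2⟩
  h_mem p q hpq x hx := by
    change ((extend.{u, w} W D.h).v p q hpq).hom x ∈ _
    rw [extend_v]
    exact ⟨h.h_mem p q hpq _ hx.1, rfl⟩

end DeformationRetract

end DGVect

/-! ### Jacobian squares along deformation retracts of pairs. -/

namespace DGPair

variable {K : Type u} [Field K] {P Q : DGPair.{u, max w u} K}

open DGVect DGVect.DeformationRetract

variable (D : DeformationRetract P.V Q.V) (hD : D.Preserves P.F Q.F)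

/-- The morphism of Jacobian squares induced by a deformation retract of pairs. -/
def jacobianSquareMap : jacobianSquare.{u, w} P ⟶ jacobianSquare.{u, w} Q where
  τ₁ := conjSub D.i_r P.δ_mem_endPart P.commutator_mem_endPart Q.δ_mem_endPart
    Q.commutator_mem_endPart (fun _ _ hξ => hD.conj_mem hD hξ)
  τ₂ := conjEnd D.i_r
  τ₃ := conjSub (DeformationRetract.addUnit.{u, w} D).i_r (δ_mem_affPart.{u, w} P)
    (commutator_mem_affPart.{u, w} P) (δ_mem_affPart.{u, w} Q) (commutator_mem_affPart.{u, w} Q)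
    (fun _ _ hξ => ⟨(preserves_top.withUnit.{u, w}).conj_mem preserves_top.withoutUnit.{u, w} hξ.1,
      (hD.withUnit.{u, w}).conj_mem hD.withoutUnit.{u, w} hξ.2⟩)
  τ₄ := conjSub (DeformationRetract.addUnit.{u, w} D).i_r (DGVect.δ_mem_affPart.{u, w} P.V)
    (DGVect.commutator_mem_affPart.{u, w} P.V) (DGVect.δ_mem_affPart.{u, w} Q.V)
    (DGVect.commutator_mem_affPart.{u, w} Q.V)
    (fun _ _ hξ => (preserves_top.withUnit.{u, w}).conj_mem preserves_top.withoutUnit.{u, w} hξ)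
  comm₁₂ := rfl
  comm₁₃ := DGLA.hom_ext fun n (x : P.endPart n) =>
    Subtype.ext (conj_extend.{u, w} D.i D.r x.1)
  comm₂₄ := DGLA.hom_ext fun n (x : Cochain P.V P.V n) =>
    Subtype.ext (conj_extend.{u, w} D.i D.r x)
  comm₃₄ := rfl

lemma isSquareWeakEquiv_jacobianSquareMap :
    DGLA.IsSquareWeakEquiv (jacobianSquareMap.{u, w} D hD) :=
  ⟨D.isWeakEquiv_conjSub P.δ_mem_endPart P.commutator_mem_endPart Q.δ_mem_endPart
      Q.commutator_mem_endPart _ (fun _ _ hη => hD.conj_mem' hD hη)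
      (fun _ _ hmn _ hη => hD.endHomotopy_mem hD hmn hη),
    D.isWeakEquiv_conjEnd,
    (DeformationRetract.addUnit.{u, w} D).isWeakEquiv_conjSub (δ_mem_affPart.{u, w} P)
      (commutator_mem_affPart.{u, w} P) (δ_mem_affPart.{u, w} Q) (commutator_mem_affPart.{u, w} Q) _
      (fun _ _ hη =>
        ⟨(preserves_top.withUnit.{u, w}).conj_mem' preserves_top.withoutUnit.{u, w} hη.1,
          (hD.withUnit.{u, w}).conj_mem' hD.withoutUnit.{u, w} hη.2⟩)
      (fun _ _ hmn _ hη =>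
        ⟨(preserves_top.withUnit.{u, w}).endHomotopy_mem preserves_top.withoutUnit.{u, w} hmn hη.1,
          (hD.withUnit.{u, w}).endHomotopy_mem hD.withoutUnit.{u, w} hmn hη.2⟩),
    (DeformationRetract.addUnit.{u, w} D).isWeakEquiv_conjSub (DGVect.δ_mem_affPart.{u, w} P.V)
      (DGVect.commutator_mem_affPart.{u, w} P.V) (DGVect.δ_mem_affPart.{u, w} Q.V)
      (DGVect.commutator_mem_affPart.{u, w} Q.V) _
      (fun _ _ hη => (preserves_top.withUnit.{u, w}).conj_mem' preserves_top.withoutUnit.{u, w} hη)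
      (fun _ _ hmn _ hη =>
        (preserves_top.withUnit.{u, w}).endHomotopy_mem preserves_top.withoutUnit.{u, w} hmn hη)⟩

end DGPair

namespace DGVect

variable {K : Type u} [Field K] {V W : DGVect.{u, w} K}

/-! ### Deformation retracts from injective quasi-isomorphisms -/

/-- The morphism induced on DG-subspaces. -/
def subMap (f : V ⟶ W) {F : ∀ n, Submodule K (V.X n)} {G : ∀ n, Submodule K (W.X n)}
    (hF : ∀ i j, ∀ x ∈ F i, (V.d i j).hom x ∈ F j) (hG : ∀ i j, ∀ x ∈ G i, (W.d i j).hom x ∈ G j)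
    (hf : ∀ n, ∀ x ∈ F n, (f.f n).hom x ∈ G n) : V.sub F hF ⟶ W.sub G hG where
  f n := ModuleCat.ofHom ((f.f n).hom.restrict (hf n))
  comm' i j _ := ModuleCat.hom_ext <| LinearMap.ext fun x => Subtype.ext (f_d f i j x.1).symm

/-- This is the acyclicity of the cokernel of i, stated without forming the quotient: a cocycle
modulo the image of i is a boundary modulo that image. -/
lemma exists_eq_add_d_of_d_eq {i : V ⟶ W} [QuasiIso i]
    (inj : ∀ n, Function.Injective (i.f n).hom) {m n k : ℤ} (hmn : m + 1 = n) (hnk : n + 1 = k)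
    (w : W.X n) (v : V.X k) (h : (W.d n k).hom w = (i.f k).hom v) :
    ∃ (v' : V.X n) (w' : W.X m), w = (i.f n).hom v' + (W.d m n).hom w' := by
  have hi := (quasiIso_iff_elements i).1 inferInstance
  have dv : (V.d k (k + 1)).hom v = 0 := inj _ (by rw [f_d, ← h, d_d, map_zero])
  obtain ⟨v', rfl⟩ := (hi n k (k + 1) hnk rfl).2 v dv w h.symm
  obtain ⟨a, -, w', hw⟩ := (hi m n k hmn hnk).1 (w - (i.f n).hom v')
    (by rw [map_sub, h, f_d, sub_self])
  exact ⟨v' + a, w', by rw [map_add, add_assoc, ← hw]; abel⟩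

/-- The elements with differential in the image of `i`. -/
def relCycles (i : V ⟶ W) (n : ℤ) : Submodule K (W.X n) :=
  (LinearMap.range (i.f (n + 1)).hom).comap (W.d n (n + 1)).hom

lemma mem_relCycles {i : V ⟶ W} {n k : ℤ} (hnk : n + 1 = k) {w : W.X n} {v : V.X k}
    (h : (W.d n k).hom w = (i.f k).hom v) : w ∈ relCycles i n := by
  subst hnk
  exact ⟨v, h.symm⟩

section Splitting

variable {i : V ⟶ W} {D : ∀ n, Submodule K (W.X n)}

/-- With `splitting_exists`, this gives Wⁿ = i Vⁿ ⊕ d Dⁿ⁻¹ ⊕ Dⁿ for D complementary to the relative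
cycles. The difference y - y' is a relative cycle lying in D, hence zero; then the same holds for x'
- x, and v = v' by injectivity. -/
lemma splitting_unique (inj : ∀ n, Function.Injective (i.f n).hom)
    (hD : ∀ n, Disjoint (relCycles i n) (D n)) {m n : ℤ} (hmn : m + 1 = n)
    {v v' : V.X n} {x x' : W.X m} {y y' : W.X n} (hx : x ∈ D m) (hx' : x' ∈ D m)
    (hy : y ∈ D n) (hy' : y' ∈ D n)
    (h : (i.f n).hom v + (W.d m n).hom x + y = (i.f n).hom v' + (W.d m n).hom x' + y') :
    v = v' ∧ x = x' ∧ y = y' := by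
  have h₁ : y - y' = (i.f n).hom (v' - v) + (W.d m n).hom (x' - x) := by
    rw [map_sub, map_sub, sub_eq_iff_eq_add, ← sub_eq_zero]
    rw [← sub_eq_zero] at h
    rw [← h]; abel
  have h₂ : y - y' = 0 := by
    refine (Submodule.disjoint_def.1 (hD n)) _ ?_ (sub_mem hy hy')
    refine mem_relCycles rfl (v := (V.d n (n + 1)).hom (v' - v)) ?_
    rw [h₁, map_add, d_d, add_zero, f_d]
  rw [h₂] at h₁
  have h₃ : x' - x = 0 := by
    refine (Submodule.disjoint_def.1 (hD m)) _ ?_ (sub_mem hx' hx)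
    refine mem_relCycles hmn (v := v - v') ?_
    rw [eq_neg_of_add_eq_zero_right h₁.symm, ← map_neg, neg_sub]
  rw [h₃, map_zero, add_zero] at h₁
  have h₄ : v' - v = 0 := inj n (by rw [← h₁, map_zero])
  exact ⟨(sub_eq_zero.1 h₄).symm, (sub_eq_zero.1 h₃).symm, sub_eq_zero.1 h₂⟩

/-- Modulo D, w is a relative cycle, hence of the form i v' + d w' by acyclicity of the cokernel;
splitting w' in turn, its relative cycle part has differential in the image of i. -/
lemma splitting_exists [QuasiIso i] (inj : ∀ n, Function.Injective (i.f n).hom)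
    (hD : ∀ n, ∀ w, ∃ ρ ∈ relCycles i n, ∃ y ∈ D n, w = ρ + y) {m n : ℤ} (hmn : m + 1 = n)
    (w : W.X n) :
    ∃ v : V.X n, ∃ x ∈ D m, ∃ y ∈ D n, w = (i.f n).hom v + (W.d m n).hom x + y := by
  obtain ⟨ρ, ⟨v, hv⟩, y, hy, rfl⟩ := hD n w
  obtain ⟨v', w', rfl⟩ := exists_eq_add_d_of_d_eq inj hmn rfl ρ v hv.symm
  obtain ⟨ρ', ⟨v'', hv''⟩, x, hx, rfl⟩ := hD m w'
  subst hmn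
  refine ⟨v' + v'', x, hx, y, hy, ?_⟩
  rw [map_add, map_add, ← hv'']
  abel

lemma splitting_linear [QuasiIso i] (inj : ∀ n, Function.Injective (i.f n).hom)
    (hD : ∀ n, IsCompl (relCycles i n) (D n)) {m n : ℤ} (hmn : m + 1 = n) :
    ∃ (r : W.X n →ₗ[K] V.X n) (h : W.X n →ₗ[K] W.X m), ∀ w,
      h w ∈ D m ∧ ∃ y ∈ D n, w = (i.f n).hom (r w) + (W.d m n).hom (h w) + y := by
  let Φ : (V.X n × D m × D n) →ₗ[K] W.X n :=
    (i.f n).hom.coprod (((W.d m n).hom ∘ₗ (D m).subtype).coprod (D n).subtype)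
  have hΦ : ∀ z, Φ z = (i.f n).hom z.1 + (W.d m n).hom z.2.1.1 + z.2.2.1 := fun z =>
    (add_assoc _ _ _).symm
  have bij : Function.Bijective Φ := by
    constructor
    · intro z z' h
      rw [hΦ, hΦ] at h
      obtain ⟨h₁, h₂, h₃⟩ := splitting_unique inj (fun n => (hD n).disjoint) hmn z.2.1.2 z'.2.1.2
        z.2.2.2 z'.2.2.2 h
      exact Prod.ext h₁ (Prod.ext (Subtype.ext h₂) (Subtype.ext h₃))
    · intro w
      obtain ⟨v, x, hx, y, hy, rfl⟩ := splitting_exists inj (fun n w => by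
        obtain ⟨ρ, hρ, y, hy, h⟩ := Submodule.mem_sup.1
          (show w ∈ relCycles i n ⊔ D n by rw [(hD n).sup_eq_top]; trivial)
        exact ⟨ρ, hρ, y, hy, h.symm⟩) hmn w
      exact ⟨(v, ⟨x, hx⟩, ⟨y, hy⟩), hΦ _⟩
  let e := LinearEquiv.ofBijective Φ bij
  refine ⟨LinearMap.fst K _ _ ∘ₗ e.symm.toLinearMap,
    (D m).subtype ∘ₗ LinearMap.fst K _ _ ∘ₗ LinearMap.snd K _ _ ∘ₗ e.symm.toLinearMap,
    fun w => ⟨(e.symm w).2.1.2, (e.symm w).2.2.1, (e.symm w).2.2.2, ?_⟩⟩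
  exact (e.apply_symm_apply w).symm.trans (hΦ (e.symm w))

/-- An injective quasi-isomorphism is part of a deformation retract, adapted to a family of
complements. -/
lemma exists_deformationRetract [QuasiIso i] (inj : ∀ n, Function.Injective (i.f n).hom)
    (hD : ∀ n, IsCompl (relCycles i n) (D n)) :
    ∃ E : DeformationRetract V W, E.i = i ∧ ∀ (m n : ℤ) (hmn : m + 1 = n) (v : V.X n),
      ∀ x ∈ D m, ∀ y ∈ D n,
        (E.r.f n).hom ((i.f n).hom v + (W.d m n).hom x + y) = v ∧
        (E.h.v n m (by lia)).hom ((i.f n).hom v + (W.d m n).hom x + y) = x := by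
  choose r h H using fun (m n : ℤ) (hmn : m + 1 = n) => splitting_linear inj hD hmn
  have key : ∀ (m n : ℤ) (hmn : m + 1 = n) (v : V.X n), ∀ x ∈ D m, ∀ y ∈ D n,
      r m n hmn ((i.f n).hom v + (W.d m n).hom x + y) = v ∧
      h m n hmn ((i.f n).hom v + (W.d m n).hom x + y) = x := by
    intro m n hmn v x hx y hy
    obtain ⟨h₁, y', hy', h₂⟩ := H m n hmn ((i.f n).hom v + (W.d m n).hom x + y)
    obtain ⟨h₃, h₄, -⟩ := splitting_unique inj (fun n => (hD n).disjoint) hmn hx h₁ hy hy' h₂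
    exact ⟨h₃.symm, h₄.symm⟩
  have key' : ∀ (m n k : ℤ) (hmn : m + 1 = n) (hnk : n + 1 = k) (w : W.X n),
      r n k hnk ((W.d n k).hom w) = (V.d n k).hom (r m n hmn w) ∧
      h n k hnk ((W.d n k).hom w) =
        w - (i.f n).hom (r m n hmn w) - (W.d m n).hom (h m n hmn w) := by
    intro m n k hmn hnk w
    obtain ⟨-, y, hy, hw⟩ := H m n hmn w
    -- If w has components (r w, h w, y), then dw has components (d (r w), y, 0). So r commutes with
    -- d, and h (dw) = y = w - i (r w) - d (h w), which is the homotopy identity.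
    have e : (W.d n k).hom w = (i.f k).hom ((V.d n k).hom (r m n hmn w)) + (W.d n k).hom y + 0 := by
      rw [hw, ← hw]
      conv_lhs => rw [hw]
      rw [map_add, map_add, d_d, f_d, add_zero, add_zero]
    obtain ⟨h₁, h₂⟩ := key n k hnk ((V.d n k).hom (r m n hmn w)) y hy 0 (zero_mem _)
    rw [← e] at h₁ h₂
    refine ⟨h₁, h₂.trans ?_⟩
    rw [eq_sub_iff_add_eq, eq_sub_iff_add_eq]
    conv_rhs => rw [hw]
    abel
  let E : DeformationRetract V W :=
    { i := i
      r :=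
        { f := fun n => ModuleCat.ofHom (r (n - 1) n (by lia))
          comm' := fun n k hnk => by
            obtain rfl : n + 1 = k := hnk
            apply ModuleCat.hom_ext
            refine LinearMap.ext fun w => ?_
            have := (key' (n - 1) n (n + 1) (by lia) rfl w).1
            refine this.symm.trans ?_
            -- The retraction in degree n + 1 was built from the predecessor n + 1 - 1, equal to n
            -- only propositionally.
            have e : ∀ m (hm : m + 1 = n + 1) (z : W.X (n + 1)),
                r n (n + 1) rfl z = r m (n + 1) hm z := by
              intro m hm z
              obtain rfl : n = m := by lia
              rfl
            exact e _ _ _ }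
      h := Cochain.mk fun p q hpq => ModuleCat.ofHom (h q p (by lia))
      i_r := by
        ext n v : 3
        have := (key (n - 1) n (by lia) v 0 (zero_mem _) 0 (zero_mem _)).1
        rw [map_zero, add_zero, add_zero] at this
        exact this
      δ_h := by
        ext p : 1
        rw [δ_v (-1) 0 (by lia) _ p p (by lia) (p - 1) (p + 1) rfl rfl, Cochain.sub_v,
          Cochain.ofHom_v, Cochain.ofHom_v, Int.negOnePow_zero, one_smul]
        apply ModuleCat.hom_ext
        refine LinearMap.ext fun w => ?_
        change (W.d (p - 1) p).hom (h (p - 1) p _ w) + h p (p + 1) _ ((W.d p (p + 1)).hom w) =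
          w - (i.f p).hom (r (p - 1) p _ w)
        rw [(key' (p - 1) p (p + 1) (by lia) rfl w).2]
        abel }
  refine ⟨E, rfl, fun m n hmn v x hx y hy => ?_⟩
  obtain rfl : m = n - 1 := by lia
  exact key _ n hmn v x hx y hy

end Splitting

/-- An injective quasi-isomorphism of pairs is part of a deformation retract of pairs. -/
lemma exists_deformationRetract_preserves (i : V ⟶ W) [QuasiIso i]
    (inj : ∀ n, Function.Injective (i.f n).hom)
    {F : ∀ n, Submodule K (V.X n)} {G : ∀ n, Submodule K (W.X n)}
    (hF : ∀ i j, ∀ x ∈ F i, (V.d i j).hom x ∈ F j) (hG : ∀ i j, ∀ x ∈ G i, (W.d i j).hom x ∈ G j)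
    (hi : ∀ n, ∀ x ∈ F n, (i.f n).hom x ∈ G n) (hi' : ∀ n x, (i.f n).hom x ∈ G n → x ∈ F n)
    [QuasiIso (subMap i hF hG hi)] :
    ∃ E : DeformationRetract V W, E.Preserves F G := by
  have hC : ∀ n, ∃ C D : Submodule K (W.X n), C ≤ G n ∧ C ≤ D ∧ IsCompl (relCycles i n) D ∧
      ∀ w ∈ G n, ∃ ρ ∈ relCycles i n, ρ ∈ G n ∧ ∃ y ∈ C, w = ρ + y := by
    intro n
    -- The complement is chosen first inside G and only then enlarged to one in W, so that the
    -- splitting of W restricts to a splitting of G.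
    obtain ⟨C₀, hC₀⟩ := Submodule.exists_isCompl ((relCycles i n).comap (G n).subtype)
    have disj : Disjoint (relCycles i n) (C₀.map (G n).subtype) := by
      rw [Submodule.disjoint_def]
      rintro _ hx ⟨x, hx', rfl⟩
      exact congrArg Subtype.val (Submodule.disjoint_def.1 hC₀.disjoint x hx hx')
    obtain ⟨D, hD, hD'⟩ := disj.symm.exists_isCompl
    refine ⟨C₀.map (G n).subtype, D, Submodule.map_subtype_le _ _, hD, hD'.symm, fun w hw => ?_⟩
    obtain ⟨ρ, hρ, y, hy, h⟩ := Submodule.mem_sup.1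
      (show (⟨w, hw⟩ : G n) ∈ _ ⊔ C₀ by rw [hC₀.sup_eq_top]; trivial)
    exact ⟨ρ.1, hρ, ρ.2, y.1, ⟨y, hy, rfl⟩, (congrArg Subtype.val h).symm⟩
  choose C D hCG hCD hD hGC using hC
  obtain ⟨E, rfl, hE⟩ := exists_deformationRetract inj hD
  -- The argument of `splitting_exists` is repeated inside G; by uniqueness of components, r and h
  -- then send G to F and to C ⊆ G.
  have split : ∀ (m n : ℤ) (hmn : m + 1 = n), ∀ w ∈ G n, ∃ v ∈ F n, ∃ x ∈ C m, ∃ y ∈ C n,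
      w = (E.i.f n).hom v + (W.d m n).hom x + y := by
    have injF : ∀ n, Function.Injective ((subMap E.i hF hG hi).f n).hom := fun n x x' h =>
      Subtype.ext (inj n (congrArg Subtype.val h))
    have acyc : ∀ (m n k : ℤ), m + 1 = n → n + 1 = k → ∀ w ∈ G n, ∀ v : V.X k,
        (W.d n k).hom w = (E.i.f k).hom v →
        ∃ v' ∈ F n, ∃ w' ∈ G m, w = (E.i.f n).hom v' + (W.d m n).hom w' := by
      intro m n k hmn hnk w hw v h
      -- That F is the whole preimage of G is what makes relative cycles of W lying in G relative
      -- cycles for F → G.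
      have hv : v ∈ F k := hi' _ _ (h ▸ hG _ _ _ hw)
      obtain ⟨v', w', h'⟩ := exists_eq_add_d_of_d_eq (i := subMap E.i hF hG hi) injF hmn hnk
        (⟨w, hw⟩ : G n) (⟨v, hv⟩ : F k) (Subtype.ext h)
      exact ⟨_, Subtype.property (p := (· ∈ F n)) v', _, Subtype.property (p := (· ∈ G m)) w',
        congrArg Subtype.val h'⟩
    intro m n hmn w hw
    obtain ⟨ρ, ⟨v, hv⟩, hρ, y, hy, rfl⟩ := hGC n w hw
    obtain ⟨v', hv', w', hw', rfl⟩ := acyc m n _ hmn rfl ρ hρ v hv.symm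
    obtain ⟨ρ', ⟨v'', hv''⟩, hρ', x, hx, rfl⟩ := hGC m w' hw'
    subst hmn
    refine ⟨v' + v'', add_mem hv' (hi' _ _ (by rw [hv'']; exact hG _ _ _ hρ')), x, hx, y, hy, ?_⟩
    rw [map_add, map_add, ← hv'']
    abel
  refine ⟨E, hi, fun n w hw => ?_, fun n m hnm w hw => ?_⟩
  · obtain ⟨v, hv, x, hx, y, hy, rfl⟩ := split (n - 1) n (by lia) w hw
    rw [(hE (n - 1) n (by lia) v x (hCD _ hx) y (hCD _ hy)).1]
    exact hv
  · obtain ⟨v, hv, x, hx, y, hy, rfl⟩ := split m n (by lia) w hw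
    rw [(hE m n (by lia) v x (hCD _ hx) y (hCD _ hy)).2]
    exact hCG _ hx

end DGVect

namespace DGVect

variable {K : Type u} [Field K] {A B U V W : DGVect.{u, w} K}

open DGLA (prodCx prodCxMap)

/-! ### Contractible complexes and cylinders -/

/-- The contractible complex with `A.X n × A.X (n + 1)` in degree `n` and `d (a, b) = (b, 0)`. -/
def contractible (A : DGVect.{u, w} K) : DGVect.{u, w} K where
  X n := ModuleCat.of K (A.X n × A.X (n + 1))
  d i j := ModuleCat.ofHom
    (LinearMap.inl K (A.X j) (A.X (j + 1)) ∘ₗ A.castX (i + 1) j ∘ₗ LinearMap.snd K _ _)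
  shape i j hij := by
    rw [A.castX_of_ne hij]
    apply ModuleCat.hom_ext
    exact LinearMap.ext fun _ => rfl
  d_comp_d' i j k _ _ := by
    apply ModuleCat.hom_ext
    exact LinearMap.ext fun x => Prod.ext (map_zero (A.castX (j + 1) k)) rfl

/-- The functoriality of `contractible`. -/
def contractibleMap (f : A ⟶ B) : contractible A ⟶ contractible B where
  f n := ModuleCat.ofHom ((f.f n).hom.prodMap (f.f (n + 1)).hom)
  comm' i j _ := ModuleCat.hom_ext <| LinearMap.ext fun x =>
    Prod.ext (castX_f f (i + 1) j x.2) (map_zero (f.f (j + 1)).hom).symm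

/-- The morphism `(f, ι) : A ⟶ B × contractible A`, where `ι a = (a, da)`. -/
def graph (f : A ⟶ B) : A ⟶ prodCx B (contractible A) where
  f n := ModuleCat.ofHom
    ((f.f n).hom.prod (LinearMap.id.prod (A.d n (n + 1)).hom))
  comm' i j hij := by
    obtain rfl : i + 1 = j := hij
    refine ModuleCat.hom_ext <| LinearMap.ext fun x => Prod.ext (f_d f i _ x).symm
      (Prod.ext ?_ (A.d_d _ _ _ x).symm)
    change A.castX (i + 1) (i + 1) ((A.d i (i + 1)).hom x) = (A.d i (i + 1)).hom x
    rw [castX_self]; rfl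

/-- The inclusion of the first factor. -/
def prodInl (U V : DGVect.{u, w} K) : U ⟶ prodCx U V where
  f n := ModuleCat.ofHom (LinearMap.inl K (U.X n) (V.X n))
  comm' i j _ := ModuleCat.hom_ext <| LinearMap.ext fun _ =>
    Prod.ext rfl (map_zero (V.d i j).hom)

/-- The projection to the first factor. -/
def prodFst (U V : DGVect.{u, w} K) : prodCx U V ⟶ U where
  f n := ModuleCat.ofHom (LinearMap.fst K (U.X n) (V.X n))
  comm' _ _ _ := rfl

/-- The retraction already forces i to be injective on cohomology, so only surjectivity has to be
supplied; r follows by two out of three. -/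
lemma quasiIso_of_retraction (i : V ⟶ W) (r : W ⟶ V) (hir : i ≫ r = 𝟙 V)
    (H : ∀ m n k : ℤ, m + 1 = n → n + 1 = k → ∀ w : W.X n, (W.d n k).hom w = 0 →
      ∃ w' : W.X m, w = (i.f n).hom ((r.f n).hom w) + (W.d m n).hom w') :
    QuasiIso i ∧ QuasiIso r := by
  have hi : QuasiIso i := by
    refine (quasiIso_iff_elements i).2 fun m n k hmn hnk => ⟨fun w hw => ?_, fun v _ w hvw => ?_⟩
    · exact ⟨(r.f n).hom w, by rw [← f_d, hw, map_zero], H m n k hmn hnk w hw⟩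
    · refine ⟨(r.f m).hom w, ?_⟩
      rw [← f_d, ← hvw, ← comp_apply, hir, id_apply]
  have : QuasiIso (i ≫ r) := by rw [hir]; infer_instance
  exact ⟨hi, quasiIso_of_comp_left i r⟩

/-- A cocycle (a, b) has b = 0, so it is the differential of (0, a). The explicit primitive keeps
track of subspaces in `quasiIso_subMap_prodInl`. -/
lemma contractible_exact (A : DGVect.{u, w} K) {m n k : ℤ} (hmn : m + 1 = n) (hnk : n + 1 = k)
    (x : A.X n × A.X (n + 1)) (hx : ((contractible A).d n k).hom x = 0) :
    ((contractible A).d m n).hom ((0, A.castX n (m + 1) x.1) : A.X m × A.X (m + 1)) = x := by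
  subst hmn hnk
  obtain ⟨a, b⟩ := x
  have hb : A.castX (m + 1 + 1) (m + 1 + 1) b = 0 := congrArg Prod.fst hx
  rw [castX_self] at hb
  refine Prod.ext ?_ hb.symm
  change A.castX (m + 1) (m + 1) (A.castX (m + 1) (m + 1) a) = a
  rw [castX_self]; rfl

lemma quasiIso_prodFst (U A : DGVect.{u, w} K) : QuasiIso (prodFst U (contractible A)) := by
  refine (quasiIso_of_retraction (prodInl U (contractible A)) (prodFst U (contractible A)) rfl
    fun m n k hmn hnk w hw => ?_).2
  refine ⟨((0, ((0, A.castX n (m + 1) w.2.1) : A.X m × A.X (m + 1))) :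
    U.X m × (contractible A).X m), Prod.ext ?_ ?_⟩
  · exact ((congrArg (w.1 + ·) (map_zero (U.d m n).hom)).trans (add_zero _)).symm
  · exact ((congrArg (0 + ·) (A.contractible_exact hmn hnk w.2 (congrArg Prod.snd hw))).trans
      (zero_add _)).symm

lemma quasiIso_of_bijective (f : V ⟶ W) (hf : ∀ n, Function.Bijective (f.f n).hom) :
    QuasiIso f := by
  refine (quasiIso_iff_elements f).2 fun m n k hmn hnk => ⟨fun w hw => ?_, fun v _ w hvw => ?_⟩
  · obtain ⟨v, rfl⟩ := (hf n).2 w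
    exact ⟨v, (hf k).1 (by rw [f_d, hw, map_zero]), 0, by rw [map_zero, add_zero]⟩
  · obtain ⟨v', rfl⟩ := (hf m).2 w
    exact ⟨v', (hf n).1 (by rw [hvw, f_d])⟩

end DGVect

/-! ### From zigzags of pairs to zigzags of Jacobian squares. -/

namespace DGPair

variable {K : Type u} [Field K]

open DGVect
open DGLA (prodCx prodCxMap SquareEquivalent)

/-- The homogeneous components of the subspace `Q.F × contractible P.F` of
`Q.V × contractible P.V`. -/
def cylinderPart (P Q : DGPair.{u, w} K) (n : ℤ) :
    Submodule K ((prodCx Q.V (contractible P.V)).X n) :=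
  ((Q.F n).prod ((P.F n).prod (P.F (n + 1))) :
    Submodule K (Q.V.X n × (P.V.X n × P.V.X (n + 1))))

lemma castX_mem (P : DGPair.{u, w} K) {i j : ℤ} {x : P.V.X i} (hx : x ∈ P.F i) :
    P.V.castX i j x ∈ P.F j := by
  by_cases h : i = j
  · subst h; rw [castX_self]; exact hx
  · rw [castX_of_ne _ h]; exact zero_mem _

/-- The DG-pair `Q × contractible P`. -/
def cylinder (P Q : DGPair.{u, w} K) : DGPair.{u, w} K where
  V := prodCx Q.V (contractible P.V)
  F := cylinderPart P Q
  d_mem i j _ hx := ⟨Q.d_mem i j _ hx.1, P.castX_mem hx.2.2, zero_mem _⟩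

lemma quasiIso_subMap_prodInl (P Q : DGPair.{u, w} K)
    (h₁ : ∀ n, ∀ x ∈ Q.F n, ((prodInl Q.V (contractible P.V)).f n).hom x ∈ (cylinder P Q).F n)
    (h₂ : ∀ n, ∀ x ∈ (cylinder P Q).F n, ((prodFst Q.V (contractible P.V)).f n).hom x ∈ Q.F n) :
    QuasiIso (subMap (prodInl Q.V (contractible P.V)) Q.d_mem (cylinder P Q).d_mem h₁) ∧
      QuasiIso (subMap (prodFst Q.V (contractible P.V)) (cylinder P Q).d_mem Q.d_mem h₂) := by
  refine quasiIso_of_retraction _ _ rfl fun m n k hmn hnk (w : (cylinder P Q).F n) hw => ?_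
  obtain ⟨⟨x, y⟩, hx, hy⟩ := w
  have hw' : ((contractible P.V).d n k).hom y = 0 :=
    congrArg Prod.snd (congrArg Subtype.val hw)
  refine ⟨(⟨((0, ((0, P.V.castX n (m + 1) y.1) : P.V.X m × P.V.X (m + 1))) :
    Q.V.X m × (contractible P.V).X m), zero_mem _, zero_mem _, P.castX_mem hy.1⟩ :
    (cylinder P Q).F m), Subtype.ext (Prod.ext ?_ ?_)⟩
  · exact ((congrArg (x + ·) (map_zero (Q.V.d m n).hom)).trans (add_zero _)).symm
  · exact ((congrArg (0 + ·) (P.V.contractible_exact hmn hnk y hw')).trans (zero_add _)).symm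

/-- DG-pairs related by an injective quasi-isomorphism have weakly equivalent Jacobian squares. -/
lemma squareEquivalent_of_injective {P Q : DGPair.{u, max w u} K} (f : P.V ⟶ Q.V) (hq : QuasiIso f)
    (inj : ∀ n, Function.Injective (f.f n).hom) (hf : ∀ n, ∀ x ∈ P.F n, (f.f n).hom x ∈ Q.F n)
    (hf' : ∀ n x, (f.f n).hom x ∈ Q.F n → x ∈ P.F n)
    (hq' : QuasiIso (subMap f P.d_mem Q.d_mem hf)) :
    SquareEquivalent (jacobianSquare.{u, w} P) (jacobianSquare.{u, w} Q) := by
  obtain ⟨D, hD⟩ := exists_deformationRetract_preserves f inj P.d_mem Q.d_mem hf hf'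
  exact .rel _ _ ⟨jacobianSquareMap.{u, w} D hD, isSquareWeakEquiv_jacobianSquareMap.{u, w} D hD⟩

/-- Quasi-isomorphic DG-pairs have weakly equivalent Jacobian squares. -/
theorem squareEquivalent_of_quasiIso {P Q : DGPair.{u, max w u} K} (f : P.V ⟶ Q.V) (hq : QuasiIso f)
    (hf : ∀ n, ∀ x ∈ P.F n, (f.f n).hom x ∈ Q.F n)
    (hq' : QuasiIso (subMap f P.d_mem Q.d_mem hf)) :
    SquareEquivalent (jacobianSquare.{u, w} P) (jacobianSquare.{u, w} Q) := by
  -- The morphism f may fail to be injective or to have P.F as the preimage of Q.F. Its graph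
  -- satisfies both, since it remembers x, and so does the inclusion of Q; they meet in `cylinder P
  -- Q`, and two out of three along the projection to Q shows that they are quasi-isomorphisms.
  have h₁ : ∀ n, ∀ x ∈ Q.F n, ((prodInl Q.V (contractible P.V)).f n).hom x ∈ (cylinder P Q).F n :=
    fun n x hx => ⟨hx, zero_mem _, zero_mem _⟩
  have h₂ : ∀ n, ∀ x ∈ (cylinder P Q).F n, ((prodFst Q.V (contractible P.V)).f n).hom x ∈ Q.F n :=
    fun n x hx => hx.1
  have h₃ : ∀ n, ∀ x ∈ P.F n, ((graph f).f n).hom x ∈ (cylinder P Q).F n :=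
    fun n x hx => ⟨hf n x hx, hx, P.d_mem _ _ _ hx⟩
  have q₁ := quasiIso_subMap_prodInl P Q h₁ h₂
  have q₂ : QuasiIso (prodFst Q.V (contractible P.V)) := quasiIso_prodFst _ _
  have q₃ : QuasiIso (prodInl Q.V (contractible P.V)) := by
    have : QuasiIso (prodInl Q.V (contractible P.V) ≫ prodFst Q.V (contractible P.V)) :=
      (inferInstance : QuasiIso (𝟙 Q.V))
    exact quasiIso_of_comp_right _ (prodFst Q.V (contractible P.V))
  have q₄ : QuasiIso (graph f) := by
    have : QuasiIso (graph f ≫ prodFst Q.V (contractible P.V)) := (inferInstance : QuasiIso f)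
    exact quasiIso_of_comp_right _ (prodFst Q.V (contractible P.V))
  have q₅ : QuasiIso (subMap (graph f) P.d_mem (cylinder P Q).d_mem h₃) := by
    have := q₁.2
    have : QuasiIso (subMap (graph f) P.d_mem (cylinder P Q).d_mem h₃ ≫
        subMap (prodFst Q.V (contractible P.V)) (cylinder P Q).d_mem Q.d_mem h₂) :=
      (inferInstance : QuasiIso (subMap f P.d_mem Q.d_mem hf))
    exact quasiIso_of_comp_right _
      (subMap (prodFst Q.V (contractible P.V)) (cylinder P Q).d_mem Q.d_mem h₂)
  refine .trans _ _ _ (squareEquivalent_of_injective (Q := cylinder P Q) (graph f) q₄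
    (fun n x y h => congrArg (fun z : Q.V.X n × (P.V.X n × P.V.X (n + 1)) => z.2.1) h) h₃
    (fun n x h => h.2.1) q₅) (.symm _ _ (squareEquivalent_of_injective (Q := cylinder P Q)
      (prodInl Q.V (contractible P.V)) q₃ (fun n x y h => congrArg Prod.fst h) h₁
      (fun n x h => h.1) q₁.1))

/-- The DG-pair replacing a morphism of DG-vector spaces by an inclusion. -/
def ofArrow (X : Arrow (DGVect.{u, w} K)) : DGPair.{u, w} K where
  V := prodCx X.right (contractible X.left)
  F n := LinearMap.range ((graph X.hom).f n).hom
  d_mem i j := by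
    rintro _ ⟨x, rfl⟩
    exact ⟨(X.left.d i j).hom x, f_d (graph X.hom) i j x⟩

/-- The identification of the source of a morphism with the subspace of the corresponding pair. -/
def toOfArrow (X : Arrow (DGVect.{u, w} K)) :
    X.left ⟶ (ofArrow X).V.sub (ofArrow X).F (ofArrow X).d_mem where
  f n := ModuleCat.ofHom ((graph X.hom).f n).hom.rangeRestrict
  comm' i j _ := ModuleCat.hom_ext <| LinearMap.ext fun x =>
    Subtype.ext (f_d (graph X.hom) i j x).symm

lemma quasiIso_toOfArrow (X : Arrow (DGVect.{u, w} K)) : QuasiIso (toOfArrow X) :=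
  quasiIso_of_bijective _ fun n => ⟨fun _ _ h => congrArg
    (fun z : X.right.X n × (X.left.X n × X.left.X (n + 1)) => z.2.1) (congrArg Subtype.val h),
    LinearMap.surjective_rangeRestrict _⟩

/-- Projecting away the contractible factor carries the graph of F ↪ V isomorphically onto F, so it
is a quasi-isomorphism of pairs back to P. -/
lemma squareEquivalent_ofArrow (P : DGPair.{u, max w u} K) :
    SquareEquivalent (jacobianSquare.{u, w} (ofArrow P.arrow)) (jacobianSquare.{u, w} P) := by
  have q := quasiIso_prodFst P.V (P.V.sub P.F P.d_mem)
  have hf : ∀ n, ∀ x ∈ (ofArrow P.arrow).F n,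
      ((prodFst P.V (contractible (P.V.sub P.F P.d_mem))).f n).hom x ∈ P.F n := by
    rintro n _ ⟨x, rfl⟩
    exact Subtype.property (p := (· ∈ P.F n)) x
  have q' : QuasiIso (subMap (prodFst P.V (contractible (P.V.sub P.F P.d_mem)))
      (ofArrow P.arrow).d_mem P.d_mem hf) := by
    have := quasiIso_toOfArrow P.arrow
    have : QuasiIso (toOfArrow P.arrow ≫ subMap (prodFst P.V (contractible (P.V.sub P.F P.d_mem)))
      (ofArrow P.arrow).d_mem P.d_mem hf) := (inferInstance : QuasiIso (𝟙 (P.V.sub P.F P.d_mem)))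
    exact quasiIso_of_comp_left (toOfArrow P.arrow) _
  exact squareEquivalent_of_quasiIso (P := ofArrow P.arrow)
    (prodFst P.V (contractible (P.V.sub P.F P.d_mem))) q hf q'

/-- The graph construction is functorial. Up to quasi-isomorphism the ambient map is `f.right`, the
contractible factors being negligible, and the map of subspaces is `f.left`. -/
lemma squareEquivalent_ofArrow_of_quasiIso {X Y : Arrow (DGVect.{u, max w u} K)} (f : X ⟶ Y)
    (h₁ : QuasiIso f.left) (h₂ : QuasiIso f.right) :
    SquareEquivalent (jacobianSquare.{u, w} (ofArrow X)) (jacobianSquare.{u, w} (ofArrow Y)) := by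
  let g : (ofArrow X).V ⟶ (ofArrow Y).V := prodCxMap f.right (contractibleMap f.left)
  have comm : graph X.hom ≫ g = f.left ≫ graph Y.hom := by
    ext n x : 3
    refine Prod.ext ?_ (Prod.ext rfl ?_)
    · exact LinearMap.congr_fun (congrArg
        (fun t : X.left ⟶ Y.right => (HomologicalComplex.Hom.f t n).hom) f.w.symm) x
    · exact f_d f.left n (n + 1) x
  have hg : ∀ n, ∀ x ∈ (ofArrow X).F n, (g.f n).hom x ∈ (ofArrow Y).F n := by
    rintro n _ ⟨x, rfl⟩
    exact ⟨(f.left.f n).hom x, (LinearMap.congr_fun (congrArg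
      (fun t : X.left ⟶ (ofArrow Y).V => (HomologicalComplex.Hom.f t n).hom) comm) x).symm⟩
  have q : QuasiIso g := by
    let p : (ofArrow Y).V ⟶ Y.right := prodFst Y.right (contractible Y.left)
    have := quasiIso_prodFst X.right X.left
    have : QuasiIso p := quasiIso_prodFst Y.right Y.left
    have : QuasiIso (g ≫ p) :=
      (inferInstance : QuasiIso (prodFst X.right (contractible X.left) ≫ f.right))
    exact quasiIso_of_comp_right g p
  have q' : QuasiIso (subMap g (ofArrow X).d_mem (ofArrow Y).d_mem hg) := by
    have := quasiIso_toOfArrow X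
    have := quasiIso_toOfArrow Y
    have e : toOfArrow X ≫ subMap g (ofArrow X).d_mem (ofArrow Y).d_mem hg =
        f.left ≫ toOfArrow Y := by
      ext n x : 3
      exact Subtype.ext (LinearMap.congr_fun (congrArg
        (fun t : X.left ⟶ (ofArrow Y).V => (HomologicalComplex.Hom.f t n).hom) comm) x)
    have : QuasiIso (toOfArrow X ≫ subMap g (ofArrow X).d_mem (ofArrow Y).d_mem hg) := by
      rw [e]; infer_instance
    exact quasiIso_of_comp_left (toOfArrow X) _
  exact squareEquivalent_of_quasiIso g q hg q'

/-- Homotopy equivalent DG-pairs have weakly equivalent Jacobian squares. -/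
theorem HomotopyEquivalent.squareEquivalent {P Q : DGPair.{u, max w u} K}
    (h : P.HomotopyEquivalent Q) :
    SquareEquivalent (jacobianSquare.{u, w} P) (jacobianSquare.{u, w} Q) := by
  -- The zigzag passes through arrows that are not inclusions of subspaces, so the induction runs
  -- over the pairs `ofArrow X`; only the two ends are compared with actual pairs.
  have key : ∀ X Y : Arrow (DGVect.{u, max w u} K), Relation.EqvGen
      (fun A B : Arrow (DGVect.{u, max w u} K) =>
        ∃ f : A ⟶ B, QuasiIso f.left ∧ QuasiIso f.right) X Y →
      SquareEquivalent (jacobianSquare.{u, w} (ofArrow X)) (jacobianSquare.{u, w} (ofArrow Y)) := by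
    intro X Y h
    induction h with
    | rel A B h =>
      obtain ⟨f, h₁, h₂⟩ := h
      exact squareEquivalent_ofArrow_of_quasiIso.{u, w} f h₁ h₂
    | refl A => exact .refl _
    | symm A B _ ih => exact .symm _ _ ih
    | trans A B C _ _ ih₁ ih₂ => exact .trans _ _ _ ih₁ ih₂
  exact .trans _ _ _ (.symm _ _ (squareEquivalent_ofArrow.{u, w} P))
    (.trans _ _ _ (key _ _ h) (squareEquivalent_ofArrow.{u, w} Q))

end DGPair

end

theorem mainTheorem11 {K : Type u} [Field K] [CharZero K] (P Q : DGPair.{u, max w u} K)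
    (h : P.HomotopyEquivalent Q) :
    (∃ L : DGLA.{u, max w u} K, DGPair.IsJacobian.{u, w} P L) ∧
    (∃ M : DGLA.{u, max w u} K, DGPair.IsJacobian.{u, w} Q M) ∧
    ∀ L M : DGLA.{u, max w u} K,
      DGPair.IsJacobian.{u, w} P L → DGPair.IsJacobian.{u, w} Q M → L.HomotopyEquivalent M :=
  ⟨DGLA.exists_isDoubleHomotopyFiber _, DGLA.exists_isDoubleHomotopyFiber _, fun _ _ hL hM =>
    DGLA.SquareEquivalent.homotopyEquivalent
      (DGPair.HomotopyEquivalent.squareEquivalent.{u, w} h) hL hM⟩
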